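/- Let $\Delta\in\mathbf F_2[[q]]$ be the reduction modulo $2$ of the series $q\prod_{n\ge 1}(1-q^n)^{24}\in\mathbf Z[[q]]$; equivalently, $\Delta=\sum_{m\ge 0}q^{(2m+1)^2}$. Let $\mathcal F\subset\mathbf F_2[\Delta]\subset\mathbf F_2[[q]]$ be the $\mathbf F_2$-vector space spanned by the odd powers $\Delta,\Delta^3,\Delta^5,\dots$. For a prime $p>2$ and $f=\sum_{n\ge 0}c(n)q^n\in\mathbf F_2[[q]]$, let $T_p(f)=\sum_{n\ge 0}\gamma(n)q^n$, where $\gamma(n)=c(pn)$ if $p\nmid n$ and $\gamma(n)=c(pn)+c(n/p)$ if $p\mid n$. If $f\in\mathcal F$, $f\ne 0$ and $T_3(f)=T_5(f)=0$, then $f=\Delta$. -/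

import Mathlib

namespace ModTwo

open PowerSeries Finset

section Discriminant

open scoped PowerSeries.WithPiTopology

/-- The integral series `Δ(q) = q ∏_{n ≥ 1} (1 - q ^ n) ^ 24 = ∑ τ(n) q ^ n`, the infinite product
being taken in the `q`-adic (coefficientwise) topology of `ℤ⟦q⟧`. -/
noncomputable def deltaInt : PowerSeries ℤ :=
  X * ∏' n : ℕ, (1 - (X : PowerSeries ℤ) ^ (n + 1)) ^ 24

end Discriminant

/-- The series `Δ` modulo `2`, in `𝔽₂⟦q⟧`. -/
noncomputable def delta : PowerSeries (ZMod 2) :=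
  PowerSeries.map (Int.castRingHom (ZMod 2)) deltaInt

/-- The `𝔽₂`-vector space `𝓕` spanned by the odd powers `Δ, Δ ^ 3, Δ ^ 5, …`, its elements being
identified with their `q`-expansions. -/
noncomputable def oddForms : Submodule (ZMod 2) (PowerSeries (ZMod 2)) :=
  Submodule.span (ZMod 2) (Set.range fun k : ℕ => delta ^ (2 * k + 1))

/-- The Hecke operator `T_p` on `q`-expansions modulo `2`: if `f = ∑ c(n) q ^ n`, the `n`-th
coefficient of `T_p f` is `c(p n)` when `p ∤ n` and `c(p n) + c(n / p)` when `p ∣ n`. -/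
noncomputable def hecke (p : ℕ) : PowerSeries (ZMod 2) →ₗ[ZMod 2] PowerSeries (ZMod 2) where
  toFun f := PowerSeries.mk fun n =>
    if p ∣ n then coeff (p * n) f + coeff (n / p) f else coeff (p * n) f
  map_add' f g := by
    ext n
    by_cases h : p ∣ n <;> simp [h, add_add_add_comm]
  map_smul' a f := by
    ext n
    by_cases h : p ∣ n <;> simp [h, mul_add]

/-! ### The expansion of `Δ` modulo `2`

The reduction of `q ∏ (1 - q ^ n) ^ 24` modulo `2` is `∑_{m ≥ 0} q ^ ((2 m + 1) ^ 2)`. -/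

lemma finite_gauss {R : Type*} [CommRing R] (q : R) (n : ℕ) :
    (∏ r ∈ range n, (1 - q ^ (2 * r + 1))) * ∑ s ∈ range (2 * n), q ^ (s * (s + 1) / 2) =
      ∑ s ∈ range n, (∏ r ∈ Ico s n, (1 - q ^ (2 * r + 2))) *
        (∏ r ∈ range s, (1 - q ^ (2 * r + 1))) * q ^ (s * (2 * n + 1)) := by
  induction n with
  | zero => simp
  | succ n ih =>
    set O : ℕ → R := fun s => ∏ r ∈ range s, (1 - q ^ (2 * r + 1)) with hO
    have hOs : ∀ s, O (s + 1) = O s * (1 - q ^ (2 * s + 1)) := fun s => prod_range_succ _ _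
    set A : ℕ → ℕ → R := fun s n => ∏ r ∈ Ico s n, (1 - q ^ (2 * r + 2)) with hA
    have hAn : ∀ s n, s ≤ n → A s (n + 1) = A s n * (1 - q ^ (2 * n + 2)) :=
      fun s n h => prod_Ico_succ_top h _
    have hAs : ∀ s n, s < n → A s n = (1 - q ^ (2 * s + 2)) * A (s + 1) n :=
      fun s n h => prod_eq_prod_Ico_succ_bot h _
    have hAA : A n n = 1 := by simp [hA]
    change O n * _ = ∑ s ∈ range n, A s n * O s * q ^ (s * (2 * n + 1)) at ih
    change O (n + 1) * _ =
      ∑ s ∈ range (n + 1), A s (n + 1) * O s * q ^ (s * (2 * (n + 1) + 1))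
    have e1 : 2 * n * (2 * n + 1) / 2 = n * (2 * n + 1) := by
      rw [mul_assoc]; exact Nat.mul_div_cancel_left _ (by norm_num)
    have e2 : (2 * n + 1) * (2 * n + 1 + 1) / 2 = (n + 1) * (2 * n + 1) := by
      rw [show (2 * n + 1) * (2 * n + 1 + 1) = 2 * ((n + 1) * (2 * n + 1)) by ring]
      exact Nat.mul_div_cancel_left _ (by norm_num)
    rw [show 2 * (n + 1) = 2 * n + 1 + 1 by ring, sum_range_succ, sum_range_succ _ (2 * n), e1, e2,
      sum_range_succ]
    have key : ∀ k, k ≤ n → ∑ s ∈ range k, A s (n + 1) * O s * q ^ (s * (2 * n + 1 + 1 + 1)) =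
        (1 - q ^ (2 * n + 1)) * ∑ s ∈ range k, A s n * O s * q ^ (s * (2 * n + 1)) +
          A k n * (1 - q ^ (2 * k)) * O k * q ^ (k * (2 * n + 1)) := by
      intro k
      induction k with
      | zero => simp
      | succ k ihk =>
        intro hk
        rw [sum_range_succ, sum_range_succ, ihk (by omega), hAn k n (by omega), hAs k n hk, hOs]
        ring
    rw [key n le_rfl, ← ih, hAn n n le_rfl, hAA, hOs]
    ring

lemma dvd_prod_sub_prod {R : Type*} [CommRing R] (y : R) (f : ℕ → R) (n m : ℕ) (h : n ≤ m)
    (hf : ∀ r, n ≤ r → y ∣ f r - 1) : y ∣ ∏ r ∈ range m, f r - ∏ r ∈ range n, f r := by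
  induction m, h using Nat.le_induction with
  | base => simp
  | succ m hm ih =>
    rw [prod_range_succ, show (∏ r ∈ range m, f r) * f m - ∏ r ∈ range n, f r =
      (∏ r ∈ range m, f r) * (f m - 1) + (∏ r ∈ range m, f r - ∏ r ∈ range n, f r) by ring]
    exact dvd_add (Dvd.dvd.mul_left (hf m hm) _) ih

open scoped PowerSeries.WithPiTopology in
lemma coeff_deltaInt (N n : ℕ) (h : N ≤ n) :
    coeff N deltaInt = coeff N (X * ∏ r ∈ range n, (1 - (X : PowerSeries ℤ) ^ (r + 1)) ^ 24) := by
  rcases N with _ | N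
  · simp [deltaInt]
  rw [deltaInt, coeff_succ_X_mul, coeff_succ_X_mul]
  have hm : Multipliable fun n : ℕ => (1 - (X : PowerSeries ℤ) ^ (n + 1)) ^ 24 :=
    (PowerSeries.WithPiTopology.multipliable_one_sub_X_pow ℤ).pow 24
  have ht := ((PowerSeries.WithPiTopology.continuous_coeff ℤ N).tendsto _).comp
    hm.hasProd.tendsto_prod_nat
  refine tendsto_nhds_unique ht (tendsto_atTop_of_eventually_const (i₀ := n) fun m hnm => ?_)
  have hd : (X : PowerSeries ℤ) ^ (n + 1) ∣
      ∏ r ∈ range m, (1 - (X : PowerSeries ℤ) ^ (r + 1)) ^ 24 -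
        ∏ r ∈ range n, (1 - (X : PowerSeries ℤ) ^ (r + 1)) ^ 24 := by
    refine dvd_prod_sub_prod _ _ n m hnm fun r hr => ?_
    have h1 : (X : PowerSeries ℤ) ^ (r + 1) ∣ (1 - X ^ (r + 1)) ^ 24 - 1 ^ 24 :=
      dvd_trans ⟨-1, by ring⟩ (sub_dvd_pow_sub_pow _ 1 24)
    rw [one_pow] at h1
    exact dvd_trans (pow_dvd_pow _ (by omega)) h1
  have := X_pow_dvd_iff.mp hd N (by omega)
  rw [map_sub, sub_eq_zero] at this
  exact this

lemma charP_two : CharP (PowerSeries (ZMod 2)) 2 :=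
  charP_of_injective_algebraMap (algebraMap (ZMod 2) (PowerSeries (ZMod 2))).injective 2

lemma one_sub_pow_24 (a : PowerSeries (ZMod 2)) : (1 - a) ^ 24 = (1 - a ^ 8) ^ 3 := by
  have := charP_two
  have h := sub_pow_char_pow (p := 2) (n := 3) (1 : PowerSeries (ZMod 2)) a
  rw [one_pow] at h
  rw [show (24 : ℕ) = 2 ^ 3 * 3 from rfl, pow_mul, h]
  rfl

lemma gauss_dvd (n : ℕ) (hn0 : 0 < n) (y : PowerSeries (ZMod 2)) (hy : constantCoeff y = 0) :
    y ^ (n + 1) ∣ ∑ s ∈ range (2 * n), y ^ (s * (s + 1) / 2) -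
      ∏ r ∈ range n, (1 - y ^ (r + 1)) ^ 3 := by
  have := charP_two
  obtain ⟨k, hn⟩ := Nat.exists_eq_succ_of_ne_zero hn0.ne'
  rw [Nat.succ_eq_add_one] at hn
  set S := ∑ s ∈ range (2 * n), y ^ (s * (s + 1) / 2)
  set P : ℕ → PowerSeries (ZMod 2) := fun n => ∏ r ∈ range n, (1 - y ^ (r + 1)) with hP
  set O := ∏ r ∈ range n, (1 - y ^ (2 * r + 1)) with hO
  set E := ∏ r ∈ range n, (1 - y ^ (2 * r + 2)) with hE
  have hEP : E = P n ^ 2 := by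
    rw [hE, hP, ← prod_pow]
    refine prod_congr rfl fun r _ => ?_
    have h := sub_pow_char (p := 2) (1 : PowerSeries (ZMod 2)) (y ^ (r + 1))
    rw [h, one_pow, ← pow_mul]
    ring_nf
  have hOE : P (2 * n) = O * E := by
    rw [hO, hE, ← prod_mul_distrib, hP]
    generalize n = m
    induction m with
    | zero => simp
    | succ m ih =>
      rw [show 2 * (m + 1) = 2 * m + 1 + 1 by ring]
      simp only at ih ⊢
      rw [prod_range_succ, prod_range_succ, prod_range_succ, ih]
      ring
  have h1 : y ^ (n + 1) ∣ O * S - E := by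
    have hE' : E = (∏ r ∈ Ico 0 n, (1 - y ^ (2 * r + 2))) *
        (∏ r ∈ range 0, (1 - y ^ (2 * r + 1))) * y ^ (0 * (2 * n + 1)) := by
      simp [hE]
    rw [finite_gauss, show range n = range (k + 1) by rw [hn], sum_range_succ', ← hE',
      add_sub_cancel_right]
    refine dvd_sum fun s _ => Dvd.dvd.mul_left (pow_dvd_pow _ ?_) _
    nlinarith
  have h2 : y ^ (n + 1) ∣ P (2 * n) - P n := by
    refine dvd_prod_sub_prod _ _ _ _ (by omega) fun r hr => ?_
    exact dvd_trans (pow_dvd_pow y (by omega : n + 1 ≤ r + 1)) ⟨-1, by ring⟩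
  have h3 : y ^ (n + 1) ∣ P n * (S - P n ^ 3) := by
    have : P n * (S - P n ^ 3) = E * (O * S - E) - (P (2 * n) - P n) * S := by
      rw [hOE, hEP]; ring
    rw [this]
    exact dvd_sub (Dvd.dvd.mul_left h1 _) (Dvd.dvd.mul_right h2 _)
  have hu : IsUnit (P n) := by
    rw [isUnit_iff_constantCoeff, hP]
    simp [hy]
  rw [prod_pow]
  exact hu.dvd_mul_left.mp h3

lemma coeff_delta (N : ℕ) [Decidable (∃ m : ℕ, N = (2 * m + 1) ^ 2)] :
    coeff N delta = if ∃ m : ℕ, N = (2 * m + 1) ^ 2 then 1 else 0 := by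
  have h0 : coeff N delta = coeff N (X * ∏ r ∈ range (N + 1),
      (1 - ((X : PowerSeries (ZMod 2)) ^ 8) ^ (r + 1)) ^ 3) := by
    rw [delta, coeff_map, coeff_deltaInt N (N + 1) (by omega), ← coeff_map, map_mul, map_prod,
      PowerSeries.map_X]
    congr 2
    refine prod_congr rfl fun r _ => ?_
    rw [map_pow, map_sub, map_one, map_pow, PowerSeries.map_X, one_sub_pow_24, ← pow_mul,
      ← pow_mul, mul_comm]
  have h1 : coeff N delta = coeff N (X * ∑ s ∈ range (2 * (N + 1)),
      ((X : PowerSeries (ZMod 2)) ^ 8) ^ (s * (s + 1) / 2)) := by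
    rw [h0]
    have hd := gauss_dvd (N + 1) N.succ_pos ((X : PowerSeries (ZMod 2)) ^ 8) (by simp)
    rw [← pow_mul] at hd
    have := X_pow_dvd_iff.mp (Dvd.dvd.mul_left hd X) N (by omega)
    rw [mul_sub, map_sub, sub_eq_zero] at this
    exact this.symm
  have h2 : ∀ s : ℕ, (X : PowerSeries (ZMod 2)) * (X ^ 8) ^ (s * (s + 1) / 2) =
      X ^ ((2 * s + 1) ^ 2) := by
    intro s
    rw [← pow_mul, ← pow_succ']
    congr 1
    obtain ⟨t, ht⟩ := Nat.even_mul_succ_self s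
    rw [ht, show (t + t) / 2 = t by omega]
    nlinarith
  rw [h1, mul_sum, sum_congr rfl fun s _ => h2 s, map_sum]
  simp only [coeff_X_pow]
  split_ifs with h
  · obtain ⟨m, hm⟩ := h
    rw [sum_eq_single m]
    · simp [hm]
    · intro b _ hb
      rw [if_neg]
      intro h
      rw [hm] at h
      have := Nat.pow_left_injective two_ne_zero h
      omega
    · intro h
      exfalso
      apply h
      rw [mem_range, hm]
      nlinarith
  · exact sum_eq_zero fun s _ => if_neg fun hs => h ⟨s, hs⟩

end ModTwo

/-! The proof finds a filtration of `oddForms` on which `T_3` and `T_5` act, to leading order, as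
two independent decrements. Write an odd exponent as `1 + 2 * (spread a + 2 * spread b)`, the binary
digits of `a` and `b` being interleaved, and give it the weight `2 a + 3 b`. Then `T_3` sends the
power with code `(a, b)` to the one with code `(a - 1, b)` plus terms of smaller weight, and `T_5`
sends it to the one with code `(a, b - 1)` plus terms of smaller weight (`lowersLeft_hecke_three`,
`lowersRight_hecke_five`). If `f` has a term of maximal weight with `a > 0`, the term `(a - 1, b)`
of `T_3 f` cannot cancel; likewise for `b > 0` and `T_5`. So if both images vanish, the maximal
weight is `0` and only `Δ` is left. The leading terms come from recurrences, and these from the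
modular equations `Δ ^ 4 + B ^ 4 = Δ B` with `B = Δ(q ^ 3)` and `(Δ + B) ^ 6 = Δ B` with `B = Δ(q ^
5)`. Both equations are identities of theta series modulo `2`: a product of two theta series counts
points of a binary quadratic form, a reflection of the form pairs off these points, and only those
on the axes of the reflection survive. The weights `α = 2`, `β = 3` are the smallest integers with
`α < β < 2 α`, which is what makes every binary carry, from `a` to `b` or from `b` to `a`, lose
weight (`exists_expo_add`). -/

namespace ModTwo

open PowerSeries Finset

/-! ### Theta series modulo two -/

/-- The series `∑ i, q ^ φ i` modulo `2`, for a function `φ` with finite fibres. -/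
noncomputable def theta {ι : Type*} (φ : ι → ℕ) : PowerSeries (ZMod 2) :=
  PowerSeries.mk fun n => (Nat.card {i // φ i = n} : ZMod 2)

lemma coeff_theta {ι : Type*} (φ : ι → ℕ) (n : ℕ) :
    coeff n (theta φ) = (Nat.card {i // φ i = n} : ZMod 2) := coeff_mk _ _

lemma theta_eq_of_bijective {ι κ : Type*} {φ : ι → ℕ} {ψ : κ → ℕ} (g : ι → κ)
    (hg : Function.Bijective g) (h : ∀ i, ψ (g i) = φ i) : theta φ = theta ψ := by
  ext n
  rw [coeff_theta, coeff_theta]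
  congr 1
  exact Nat.card_congr ((Equiv.ofBijective g hg).subtypeEquiv fun i => by simp [h])

lemma theta_sumElim {ι κ : Type*} {φ : ι → ℕ} {ψ : κ → ℕ} (hφ : ∀ n, Finite {i // φ i = n})
    (hψ : ∀ n, Finite {i // ψ i = n}) : theta (Sum.elim φ ψ) = theta φ + theta ψ := by
  ext n
  have := hφ n
  have := hψ n
  rw [map_add, coeff_theta, coeff_theta, coeff_theta, ← Nat.cast_add, ← Nat.card_sum]
  congr 1
  exact Nat.card_congr (Equiv.subtypeSum (p := fun x => Sum.elim φ ψ x = n))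

/-- The pairs of total weight `n`, sorted by the weights of their components. -/
def pairFibreEquiv {ι κ : Type*} (φ : ι → ℕ) (ψ : κ → ℕ) (n : ℕ) :
    {p : ι × κ // φ p.1 + ψ p.2 = n} ≃
      Σ a : antidiagonal n, {i // φ i = a.1.1} × {j // ψ j = a.1.2} where
  toFun p := ⟨⟨(φ p.1.1, ψ p.1.2), mem_antidiagonal.mpr p.2⟩, ⟨p.1.1, rfl⟩, ⟨p.1.2, rfl⟩⟩
  invFun a := ⟨(a.2.1.1, a.2.2.1), by
    rw [a.2.1.2, a.2.2.2]; exact mem_antidiagonal.mp a.1.2⟩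
  left_inv p := rfl
  right_inv := by
    rintro ⟨⟨⟨a, b⟩, h⟩, ⟨i, hi⟩, ⟨j, hj⟩⟩
    dsimp only at hi hj
    subst hi hj
    rfl

lemma finite_pairFibre {ι κ : Type*} {φ : ι → ℕ} {ψ : κ → ℕ} (hφ : ∀ n, Finite {i // φ i = n})
    (hψ : ∀ n, Finite {i // ψ i = n}) (n : ℕ) : Finite {p : ι × κ // φ p.1 + ψ p.2 = n} :=
  Finite.of_equiv _ (pairFibreEquiv φ ψ n).symm

lemma theta_mul {ι κ : Type*} {φ : ι → ℕ} {ψ : κ → ℕ} (hφ : ∀ n, Finite {i // φ i = n})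
    (hψ : ∀ n, Finite {i // ψ i = n}) :
    theta φ * theta ψ = theta fun p : ι × κ => φ p.1 + ψ p.2 := by
  ext n
  rw [coeff_mul, coeff_theta, Nat.card_congr (pairFibreEquiv φ ψ n), Nat.card_sigma]
  simp_rw [Nat.card_prod, coeff_theta]
  push_cast
  exact (sum_coe_sort (antidiagonal n) fun a : ℕ × ℕ =>
    (Nat.card {i // φ i = a.1} : ZMod 2) * (Nat.card {j // ψ j = a.2} : ZMod 2)).symm

lemma theta_expand {ι : Type*} (φ : ι → ℕ) (p : ℕ) (hp : p ≠ 0) :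
    expand p hp (theta φ) = theta fun i => p * φ i := by
  ext n
  rw [coeff_expand, coeff_theta]
  split_ifs with h
  · obtain ⟨m, rfl⟩ := h
    rw [coeff_theta, Nat.mul_div_cancel_left _ (Nat.pos_of_ne_zero hp)]
    congr 1
    exact Nat.card_congr (Equiv.subtypeEquivRight fun i => by
      rw [Nat.mul_right_inj hp])
  · have : IsEmpty {i // p * φ i = n} := ⟨fun i => h ⟨_, i.2.symm⟩⟩
    rw [coeff_theta, Nat.card_of_isEmpty, Nat.cast_zero]

/-- Orbits of length two cancel modulo `2`. This is the only source of theta identities below. -/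
lemma theta_involution {ι : Type*} {φ : ι → ℕ} (hφ : ∀ n, Finite {i // φ i = n}) (σ : ι → ι)
    (hσ : ∀ i, σ (σ i) = i) (h : ∀ i, φ (σ i) = φ i) :
    theta φ = theta fun i : {i // σ i = i} => φ i := by
  classical
  ext n
  have := hφ n
  have := Fintype.ofFinite {i // φ i = n}
  let f : Function.End {i // φ i = n} := fun i => ⟨σ i, (h i).trans i.2⟩
  have hf : f ^ 2 ^ 1 = 1 := by
    rw [pow_one, pow_two]
    funext i
    exact Subtype.ext (hσ i)
  have key := Equiv.Perm.card_fixedPoints_modEq hf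
  rw [coeff_theta, coeff_theta, Nat.card_eq_fintype_card, (ZMod.natCast_eq_natCast_iff _ _ _).mpr key,
    ← Nat.card_eq_fintype_card]
  congr 1
  refine Nat.card_congr
    ⟨fun i => ⟨⟨i.1.1, congrArg Subtype.val i.2⟩, i.1.2⟩,
      fun i => ⟨⟨i.1.1, i.2⟩, Subtype.ext i.1.2⟩, fun _ => rfl, fun _ => rfl⟩

lemma finite_mul_sq_fibre {ι : Type*} (f : ι → ℤ) (hf : Function.Injective f) (c : ℕ) (hc : c ≠ 0)
    (n : ℕ) : Finite {i // c * (f i).natAbs ^ 2 = n} := by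
  refine Finite.of_injective (β := Set.Icc (-(n : ℤ)) n) (fun i => ⟨f i, ?_⟩) fun i j hij => ?_
  · have h1 : (f i).natAbs ≤ n := by
      calc (f i).natAbs ≤ (f i).natAbs ^ 2 := Nat.le_self_pow two_ne_zero _
        _ ≤ c * (f i).natAbs ^ 2 := Nat.le_mul_of_pos_left _ (Nat.pos_of_ne_zero hc)
        _ = n := i.2
    rw [Set.mem_Icc]
    omega
  · exact Subtype.ext (hf (congrArg Subtype.val hij))

/-- The integers congruent to `1` modulo `4`: one from each pair `±x` with `x` odd. -/
abbrev OneModFour : Type := {x : ℤ // x % 4 = 1}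

/-- The integers congruent to `1` modulo `6`: one from each pair `±x` with `x` prime to `6`. -/
abbrev OneModSix : Type := {x : ℤ // x % 6 = 1}

/-- The series `∑ q ^ (c x ^ 2)` over the odd positive integers `x`. -/
noncomputable def thetaOdd (c : ℕ) : PowerSeries (ZMod 2) :=
  theta fun x : OneModFour => c * x.1.natAbs ^ 2

/-- The series `∑ q ^ (c x ^ 2)` over the positive integers `x` prime to `6`. -/
noncomputable def thetaSix (c : ℕ) : PowerSeries (ZMod 2) :=
  theta fun x : OneModSix => c * x.1.natAbs ^ 2

lemma finite_odd (c : ℕ) (hc : c ≠ 0) (n : ℕ) :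
    Finite {x : OneModFour // c * x.1.natAbs ^ 2 = n} :=
  finite_mul_sq_fibre _ Subtype.val_injective c hc n

lemma finite_six (c : ℕ) (hc : c ≠ 0) (n : ℕ) :
    Finite {x : OneModSix // c * x.1.natAbs ^ 2 = n} :=
  finite_mul_sq_fibre _ Subtype.val_injective c hc n

lemma expand_thetaOdd (c p : ℕ) (hp : p ≠ 0) : expand p hp (thetaOdd c) = thetaOdd (p * c) := by
  simp only [thetaOdd, theta_expand, mul_assoc]

lemma expand_thetaSix (c p : ℕ) (hp : p ≠ 0) : expand p hp (thetaSix c) = thetaSix (p * c) := by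
  simp only [thetaSix, theta_expand, mul_assoc]

lemma delta_eq_thetaOdd : delta = thetaOdd 1 := by
  classical
  ext n
  rw [coeff_delta, thetaOdd, coeff_theta]
  have hs : Subsingleton {x : OneModFour // 1 * x.1.natAbs ^ 2 = n} := by
    refine ⟨fun ⟨⟨x, hx⟩, hx'⟩ ⟨⟨y, hy⟩, hy'⟩ => ?_⟩
    dsimp only at hx' hy'
    have : x.natAbs = y.natAbs := Nat.pow_left_injective two_ne_zero (by dsimp only; omega)
    simp only [Subtype.mk.injEq]
    omega
  split_ifs with h
  · obtain ⟨m, rfl⟩ := h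
    have : Nonempty {x : OneModFour // 1 * x.1.natAbs ^ 2 = (2 * m + 1) ^ 2} := by
      rcases Nat.even_or_odd' m with ⟨k, rfl | rfl⟩
      · refine ⟨⟨⟨2 * (2 * k : ℕ) + 1, by omega⟩, ?_⟩⟩
        rw [one_mul]; congr 1
      · refine ⟨⟨⟨-(2 * (2 * k + 1 : ℕ) + 1), by omega⟩, ?_⟩⟩
        rw [one_mul]; congr 1
    rw [Nat.card_eq_one_iff_unique.mpr ⟨hs, this⟩, Nat.cast_one]
  · have : IsEmpty {x : OneModFour // 1 * x.1.natAbs ^ 2 = n} := by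
      refine ⟨fun ⟨⟨x, hx⟩, hx'⟩ => h ⟨(x.natAbs - 1) / 2, ?_⟩⟩
      dsimp only at hx'
      rw [← hx', one_mul]; congr 1; omega
    rw [Nat.card_of_isEmpty, Nat.cast_zero]

lemma expand_delta (p : ℕ) (hp : p ≠ 0) : expand p hp delta = thetaOdd p := by
  rw [delta_eq_thetaOdd, expand_thetaOdd, mul_one]

/-- Frobenius is the identity on the coefficients, so squaring is the substitution `q ↦ q ^ 2`. -/
lemma sq_eq_expand (f : PowerSeries (ZMod 2)) : f ^ 2 = expand 2 two_ne_zero f := by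
  have h := MvPowerSeries.map_frobenius_expand (σ := Unit) (R := ZMod 2) 2 two_ne_zero (f := f)
  rw [ZMod.frobenius_zmod] at h
  rw [← h]
  simp [expand]

lemma expand_injective (p : ℕ) (hp : p ≠ 0) :
    Function.Injective (expand p hp : PowerSeries (ZMod 2) → PowerSeries (ZMod 2)) := by
  intro f g h
  ext n
  rw [← coeff_expand_mul p hp f, ← coeff_expand_mul p hp g, h]

/-! ### Reflections of binary quadratic forms -/

/-- The representative of `±z` whose first component is congruent to `1` modulo `4`, when that
component is odd. -/
def signNormal (z : ℤ × ℤ) : ℤ × ℤ := if z.1 % 4 = 1 then z else (-z.1, -z.2)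

/-- The value of the form `x ^ 2 + c y ^ 2`. -/
def formValue (c : ℕ) (z : ℤ × ℤ) : ℕ := z.1.natAbs ^ 2 + c * z.2.natAbs ^ 2

lemma cast_formValue (c : ℕ) (z : ℤ × ℤ) : (formValue c z : ℤ) = z.1 ^ 2 + c * z.2 ^ 2 := by
  unfold formValue
  push_cast
  simp only [sq_abs]

lemma formValue_signNormal (c : ℕ) (z : ℤ × ℤ) : formValue c (signNormal z) = formValue c z := by
  unfold signNormal formValue
  split_ifs <;> simp

/-- The series `∑ q ^ (x ^ 2 + c y ^ 2)` over the integral points of a set. -/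
noncomputable def thetaForm (c : ℕ) (P : ℤ × ℤ → Prop) : PowerSeries (ZMod 2) :=
  theta fun z : {z // P z} => formValue c z.1

lemma finite_formValue (c : ℕ) (hc : c ≠ 0) (P : ℤ × ℤ → Prop) (n : ℕ) :
    Finite {z : {z // P z} // formValue c z.1 = n} := by
  have := finite_pairFibre (finite_mul_sq_fibre id Function.injective_id 1 one_ne_zero)
    (finite_mul_sq_fibre id Function.injective_id c hc) n
  refine Finite.of_injective (β := {p : ℤ × ℤ // 1 * (id p.1).natAbs ^ 2 +
    c * (id p.2).natAbs ^ 2 = n}) (fun z => ⟨z.1.1, ?_⟩) fun z w h => ?_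
  · rw [one_mul]; exact z.2
  · exact Subtype.ext (Subtype.ext (Subtype.mk.inj h))

lemma thetaForm_involution (c : ℕ) (hc : c ≠ 0) {P : ℤ × ℤ → Prop} (σ : ℤ × ℤ → ℤ × ℤ)
    (hP : ∀ z, P z → P (σ z)) (hσ : ∀ z, P z → σ (σ z) = z)
    (h : ∀ z, P z → formValue c (σ z) = formValue c z) :
    thetaForm c P = thetaForm c fun z => P z ∧ σ z = z := by
  rw [thetaForm, theta_involution (finite_formValue c hc P) (fun z => ⟨σ z.1, hP _ z.2⟩)
    (fun z => Subtype.ext (hσ _ z.2)) fun z => h _ z.2]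
  exact theta_eq_of_bijective
    (fun z => ⟨z.1.1, z.1.2, congrArg Subtype.val z.2⟩)
    ⟨fun z w h => Subtype.ext (Subtype.ext (Subtype.mk.inj h)),
      fun z => ⟨⟨⟨z.1, z.2.1⟩, Subtype.ext z.2.2⟩, rfl⟩⟩ fun _ => rfl

lemma thetaForm_reindex {ι : Type*} (c : ℕ) {P : ℤ × ℤ → Prop} {ψ : ι → ℕ} (g : ι → ℤ × ℤ)
    (hg : Function.Injective g) (hP : ∀ z, P z ↔ ∃ i, g i = z)
    (h : ∀ i, formValue c (g i) = ψ i) : theta ψ = thetaForm c P :=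
  theta_eq_of_bijective (fun i => ⟨g i, (hP _).mpr ⟨i, rfl⟩⟩)
    ⟨fun i j h => hg (Subtype.mk.inj h), fun z => by
      obtain ⟨i, hi⟩ := (hP _).mp z.2
      exact ⟨i, Subtype.ext hi⟩⟩ h

/-- Meant for `P` the fixed points of a reflection up to sign: they lie on a line, parametrised by
`g`. The next lemma treats two lines. -/
lemma thetaForm_eq_thetaOdd (c a : ℕ) {P : ℤ × ℤ → Prop} (g : ℤ → ℤ × ℤ)
    (hg : Function.Injective g) (hP : ∀ z, P z ↔ ∃ t, t % 4 = 1 ∧ g t = z)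
    (h : ∀ t, (formValue c (g t) : ℤ) = a * t ^ 2) : thetaForm c P = thetaOdd a := by
  refine (thetaForm_reindex c (fun t : OneModFour => g t) (hg.comp Subtype.val_injective)
    (fun z => ?_) fun t => ?_).symm
  · rw [hP]; simp
  · zify; rw [sq_abs]; exact h t

lemma thetaForm_eq_thetaOdd_add (c a b : ℕ) (ha : a ≠ 0) (hb : b ≠ 0) {P : ℤ × ℤ → Prop}
    (g k : ℤ → ℤ × ℤ) (hg : Function.Injective g) (hk : Function.Injective k)
    (hgk : ∀ s t, s % 4 = 1 → g s ≠ k t)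
    (hP : ∀ z, P z ↔ ∃ t, t % 4 = 1 ∧ (g t = z ∨ k t = z))
    (h : ∀ t, (formValue c (g t) : ℤ) = a * t ^ 2)
    (h' : ∀ t, (formValue c (k t) : ℤ) = b * t ^ 2) :
    thetaForm c P = thetaOdd a + thetaOdd b := by
  rw [thetaOdd, thetaOdd, ← theta_sumElim (finite_odd a ha) (finite_odd b hb)]
  refine (thetaForm_reindex c (Sum.elim (fun t : OneModFour => g t) fun t : OneModFour => k t)
    ?_ (fun z => ?_) ?_).symm
  · exact (hg.comp Subtype.val_injective).sumElim (hk.comp Subtype.val_injective)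
      fun s t => hgk s t s.2
  · rw [hP]
    simp only [Sum.exists, Sum.elim_inl, Sum.elim_inr, Subtype.exists, exists_prop]
    rw [← exists_or]
    exact exists_congr fun t => and_or_left
  · rintro (t | t)
    · rw [Sum.elim_inl, Sum.elim_inl]; zify; rw [sq_abs]; exact h t
    · rw [Sum.elim_inr, Sum.elim_inr]; zify; rw [sq_abs]; exact h' t

/-- The form is `x ^ 2 + 3 y ^ 2` and the involution is a reflection taken modulo `± 1`. Its two
axes are `y = -x`, where the form is `4 t ^ 2`, and `x = 3 y`, where it is `12 t ^ 2`. -/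
lemma thetaOdd_one_mul_three : thetaOdd 1 * thetaOdd 3 = thetaOdd 4 + thetaOdd 12 := by
  rw [thetaOdd, thetaOdd, theta_mul (finite_odd 1 one_ne_zero) (finite_odd 3 three_ne_zero),
    -- The second coordinate is negated so that `x - y` and `x + 3 y` are `2` modulo `4`: their
    -- halves are then odd, and the reflection preserves the index set up to sign.
    thetaForm_reindex 3 (P := fun z => z.1 % 4 = 1 ∧ z.2 % 4 = 3)
      (fun p : OneModFour × OneModFour => (p.1.1, -p.2.1)),
    thetaForm_involution 3 three_ne_zero
      fun z => signNormal ((z.1 + 3 * z.2) / 2, (z.1 - z.2) / 2)]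
  · refine thetaForm_eq_thetaOdd_add 3 4 12 (by norm_num) (by norm_num)
      (fun t => (t, -t)) (fun t => (-3 * t, -t)) ?_ ?_ ?_ ?_ ?_ ?_
    · intro s t h; simpa using h
    · intro s t h; simpa using h
    · intro s t hs h; simp only [Prod.mk.injEq] at h; omega
    · rintro ⟨x, y⟩
      simp only [signNormal, Prod.mk.injEq]
      constructor
      · rintro ⟨⟨hx, hy⟩, h⟩
        by_cases hxy : y = -x
        · exact ⟨x, hx, Or.inl (by omega)⟩
        · refine ⟨-y, by omega, Or.inr ?_⟩
          split_ifs at h <;> simp only [Prod.mk.injEq] at h <;> omega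
      · rintro ⟨t, ht, h⟩
        refine ⟨by omega, ?_⟩
        split_ifs <;> simp only [Prod.mk.injEq] <;> omega
    · intro t; rw [cast_formValue]; push_cast; ring
    · intro t; rw [cast_formValue]; push_cast; ring
  · rintro ⟨x, y⟩ h
    simp only [signNormal] at h ⊢
    split_ifs <;> dsimp only at * <;> omega
  · rintro ⟨x, y⟩ h
    simp only [signNormal] at h ⊢
    split_ifs <;> ext <;> dsimp only at * <;> omega
  · rintro ⟨x, y⟩ h
    dsimp only at h
    obtain ⟨t, rfl⟩ : ∃ t, x = y + 2 * t := ⟨(x - y) / 2, by omega⟩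
    rw [formValue_signNormal]
    dsimp only
    rw [show (y + 2 * t + 3 * y) / 2 = 2 * y + t by omega, show (y + 2 * t - y) / 2 = t by omega]
    zify [cast_formValue]
    ring
  · rintro ⟨⟨a, ha⟩, ⟨b, hb⟩⟩ ⟨⟨c, hc⟩, ⟨d, hd⟩⟩ h
    simpa using h
  · rintro ⟨x, y⟩
    constructor
    · rintro ⟨hx, hy⟩
      exact ⟨(⟨x, hx⟩, ⟨-y, by dsimp only at hy; omega⟩), by simp⟩
    · rintro ⟨⟨⟨a, ha⟩, ⟨b, hb⟩⟩, h⟩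
      simp only [Prod.mk.injEq] at h ⊢
      omega
  · intro p; simp [formValue]

/-- The points with odd coordinates congruent modulo `3`, one from each pair `±z`. -/
def OddCongrThree (z : ℤ × ℤ) : Prop := z.1 % 4 = 1 ∧ z.2 % 2 = 1 ∧ z.1 % 3 = z.2 % 3

/-- The index set of the product is not stable under the reflections used next, whose images may
have both coordinates divisible by `3`. Adding all such points changes nothing modulo `2`, since `y
↦ -y` pairs them off (`y` is odd, hence nonzero). -/
lemma thetaSix_mul (c : ℕ) (hc : c ≠ 0) :
    thetaSix 1 * thetaSix c = thetaForm c OddCongrThree := by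
  rw [thetaSix, thetaSix, theta_mul (finite_six 1 one_ne_zero) (finite_six c hc),
    thetaForm_involution c hc fun z => if z.1 % 3 = 0 then (z.1, -z.2) else z]
  · refine thetaForm_reindex c (fun p : OneModSix × OneModSix => signNormal (p.1.1, p.2.1))
      ?_ ?_ ?_
    · rintro ⟨⟨a, ha⟩, ⟨b, hb⟩⟩ ⟨⟨c, hc⟩, ⟨d, hd⟩⟩ h
      simp only [signNormal] at h
      simp only [Prod.mk.injEq, Subtype.mk.injEq]
      split_ifs at h <;> simp only [Prod.mk.injEq] at h <;> omega
    · rintro ⟨x, y⟩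
      simp only [OddCongrThree, signNormal]
      constructor
      · rintro ⟨h, h'⟩
        have hx : x % 3 ≠ 0 := by
          intro hx
          rw [if_pos hx] at h'
          simp only [Prod.mk.injEq] at h'
          omega
        by_cases h1 : x % 3 = 1
        · exact ⟨(⟨x, by omega⟩, ⟨y, by omega⟩), if_pos h.1⟩
        · refine ⟨(⟨-x, by omega⟩, ⟨-y, by omega⟩), ?_⟩
          rw [if_neg (by dsimp only; omega)]
          simp
      · rintro ⟨⟨⟨a, ha⟩, ⟨b, hb⟩⟩, h⟩
        dsimp only at h
        split_ifs at h <;> simp only [Prod.mk.injEq] at h <;>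
          exact ⟨by omega, if_neg (by omega)⟩
    · intro p; rw [formValue_signNormal]; simp [formValue]
  · rintro ⟨x, y⟩ h
    simp only [OddCongrThree] at h ⊢
    split_ifs <;> dsimp only at * <;> omega
  · rintro ⟨x, y⟩ h
    dsimp only
    by_cases hx : x % 3 = 0 <;> simp [hx]
  · rintro ⟨x, y⟩ h
    dsimp only
    by_cases hx : x % 3 = 0 <;> simp [hx, formValue]

/-- Of the two axes `x = y` and `x = -2 y` of this reflection, the second has no point with `x` odd;
on the first the form is `3 t ^ 2`. -/
lemma thetaSix_one_mul_two : thetaSix 1 * thetaSix 2 = thetaOdd 3 := by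
  rw [thetaSix_mul 2 two_ne_zero, thetaForm_involution 2 two_ne_zero
      fun z => signNormal ((-z.1 + 4 * z.2) / 3, (2 * z.1 + z.2) / 3)]
  · refine thetaForm_eq_thetaOdd 2 3 (fun t => (t, t)) ?_ ?_ ?_
    · intro s t h; simpa using h
    · rintro ⟨x, y⟩
      simp only [signNormal, Prod.mk.injEq, OddCongrThree]
      constructor
      · rintro ⟨hx, h⟩
        refine ⟨x, hx.1, rfl, ?_⟩
        split_ifs at h <;> simp only [Prod.mk.injEq] at h <;> omega
      · rintro ⟨t, ht, h⟩
        refine ⟨by omega, ?_⟩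
        split_ifs <;> simp only [Prod.mk.injEq] <;> omega
    · intro t; rw [cast_formValue]; push_cast; ring
  · rintro ⟨x, y⟩ h
    simp only [OddCongrThree, signNormal] at h ⊢
    split_ifs <;> dsimp only at * <;> omega
  · rintro ⟨x, y⟩ h
    simp only [OddCongrThree, signNormal] at h ⊢
    split_ifs <;> ext <;> dsimp only at * <;> omega
  · rintro ⟨x, y⟩ h
    dsimp only [OddCongrThree] at h
    obtain ⟨t, rfl⟩ : ∃ t, x = y + 3 * t := ⟨(x - y) / 3, by omega⟩
    rw [formValue_signNormal]
    dsimp only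
    rw [show (-(y + 3 * t) + 4 * y) / 3 = y - t by omega,
      show (2 * (y + 3 * t) + y) / 3 = y + 2 * t by omega]
    zify [cast_formValue]
    ring

/-- The axes are `x = y` and `x = -5 y`, where `x ^ 2 + 5 y ^ 2` takes the values `6 t ^ 2` and `30
t ^ 2`. -/
lemma thetaSix_one_mul_five : thetaSix 1 * thetaSix 5 = thetaOdd 6 + thetaOdd 30 := by
  rw [thetaSix_mul 5 (by norm_num), thetaForm_involution 5 (by norm_num)
      fun z => signNormal ((2 * z.1 - 5 * z.2) / 3, -(z.1 + 2 * z.2) / 3)]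
  · refine thetaForm_eq_thetaOdd_add 5 6 30 (by norm_num) (by norm_num)
      (fun t => (t, t)) (fun t => (5 * t, -t)) ?_ ?_ ?_ ?_ ?_ ?_
    · intro s t h; simpa using h
    · intro s t h; simpa using h
    · intro s t hs h; simp only [Prod.mk.injEq] at h; omega
    · rintro ⟨x, y⟩
      simp only [signNormal, Prod.mk.injEq, OddCongrThree]
      constructor
      · rintro ⟨hx, h⟩
        by_cases hxy : y = x
        · exact ⟨x, hx.1, Or.inl (by omega)⟩
        · have h' : x = -5 * y := by
            split_ifs at h <;> simp only [Prod.mk.injEq] at h <;> omega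
          exact ⟨-y, by omega, Or.inr (by omega)⟩
      · rintro ⟨t, ht, h⟩
        refine ⟨by omega, ?_⟩
        split_ifs <;> simp only [Prod.mk.injEq] <;> omega
    · intro t; rw [cast_formValue]; push_cast; ring
    · intro t; rw [cast_formValue]; push_cast; ring
  · rintro ⟨x, y⟩ h
    simp only [OddCongrThree, signNormal] at h ⊢
    split_ifs <;> dsimp only at * <;> omega
  · rintro ⟨x, y⟩ h
    simp only [OddCongrThree, signNormal] at h ⊢
    split_ifs <;> ext <;> dsimp only at * <;> omega
  · rintro ⟨x, y⟩ h
    dsimp only [OddCongrThree] at h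
    obtain ⟨t, rfl⟩ : ∃ t, x = y + 3 * t := ⟨(x - y) / 3, by omega⟩
    rw [formValue_signNormal]
    dsimp only
    rw [show (2 * (y + 3 * t) - 5 * y) / 3 = 2 * t - y by omega,
      show -(y + 3 * t + 2 * y) / 3 = - y - t by omega]
    zify [cast_formValue]
    ring

/-! ### The modular equations of degrees three and five -/

theorem modularEquation_three (h : (3 : ℕ) ≠ 0) :
    delta ^ 4 + expand 3 h delta ^ 4 = delta * expand 3 h delta := by
  have h4 : ∀ f : PowerSeries (ZMod 2), f ^ 4 = expand 2 two_ne_zero (expand 2 two_ne_zero f) := by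
    intro f
    rw [← sq_eq_expand, ← sq_eq_expand, ← pow_mul]
  rw [h4, h4, delta_eq_thetaOdd]
  simp only [expand_thetaOdd]
  exact thetaOdd_one_mul_three.symm

/-- After `q ↦ q ^ 3` both `Δ` and `Δ(q ^ 5)` become cubes, of `thetaSix 1` and `thetaSix 5`. The
equation is then the cube of `(Δ(q ^ 3) + Δ(q ^ 15)) ^ 2 = thetaSix 1 * thetaSix 5`. -/
theorem modularEquation_five (h : (5 : ℕ) ≠ 0) :
    (delta + expand 5 h delta) ^ 6 = delta * expand 5 h delta := by
  apply expand_injective 3 three_ne_zero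
  have e3 : thetaSix 1 ^ 3 = thetaOdd 3 := by
    rw [← thetaSix_one_mul_two, pow_succ', sq_eq_expand, expand_thetaSix]
  have e15 : thetaSix 5 ^ 3 = thetaOdd 15 := by
    have := congrArg (expand 5 h) e3
    rwa [map_pow, expand_thetaSix, expand_thetaOdd] at this
  have key : (thetaOdd 3 + thetaOdd 15) ^ 2 = thetaSix 1 * thetaSix 5 := by
    rw [sq_eq_expand, map_add, expand_thetaOdd, expand_thetaOdd, thetaSix_one_mul_five]
  rw [map_pow, map_mul, map_add, expand_delta, expand_delta, expand_thetaOdd, ← e3]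
  change (_ + thetaOdd 15) ^ 6 = _ * thetaOdd 15
  rw [← e15, ← mul_pow, ← key, e3, e15]
  ring

/-! ### Hecke operators on powers of `Δ` -/

/-- The operator `U_p`, sending `∑ c(n) q ^ n` to `∑ c(p n) q ^ n`. -/
noncomputable def heckeU (p : ℕ) : PowerSeries (ZMod 2) →ₗ[ZMod 2] PowerSeries (ZMod 2) where
  toFun f := PowerSeries.mk fun n => coeff (p * n) f
  map_add' f g := by ext n; simp
  map_smul' a f := by ext n; simp

lemma coeff_heckeU (p n : ℕ) (f : PowerSeries (ZMod 2)) :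
    coeff n (heckeU p f) = coeff (p * n) f := by
  simp [heckeU]

lemma coeff_hecke (p n : ℕ) (f : PowerSeries (ZMod 2)) : coeff n (hecke p f) =
    if p ∣ n then coeff (p * n) f + coeff (n / p) f else coeff (p * n) f := by
  simp [hecke]

lemma hecke_eq (p : ℕ) (hp : p ≠ 0) (f : PowerSeries (ZMod 2)) :
    hecke p f = heckeU p f + expand p hp f := by
  ext n
  rw [map_add, coeff_hecke, coeff_heckeU, coeff_expand]
  split_ifs <;> simp

/-- The projection formula: `expand p hp g` has only exponents divisible by `p`, so in degree `p n`
the other factor is also read at multiples of `p`. -/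
lemma heckeU_expand_mul (p : ℕ) (hp : p ≠ 0) (g f : PowerSeries (ZMod 2)) :
    heckeU p (expand p hp g * f) = g * heckeU p f := by
  ext n
  rw [coeff_heckeU, coeff_mul, coeff_mul]
  symm
  refine sum_of_injOn (fun a => (p * a.1, p * a.2)) ?_ ?_ ?_ ?_
  · rintro ⟨a, b⟩ _ ⟨c, d⟩ _ h
    simpa [hp] using h
  · rintro ⟨a, b⟩ h
    simp only [mem_coe, HasAntidiagonal.mem_antidiagonal] at h ⊢
    rw [← mul_add, h]
  · rintro ⟨a, b⟩ h h'
    rw [HasAntidiagonal.mem_antidiagonal] at h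
    dsimp only at h ⊢
    rw [coeff_expand_of_not_dvd, zero_mul]
    rintro ⟨c, rfl⟩
    obtain ⟨d, rfl⟩ : p ∣ b := (Nat.dvd_add_right (dvd_mul_right p c)).mp ⟨n, h⟩
    refine h' ⟨(c, d), ?_, rfl⟩
    rw [mem_coe, HasAntidiagonal.mem_antidiagonal]
    rw [← mul_add] at h
    exact Nat.eq_of_mul_eq_mul_left (Nat.pos_of_ne_zero hp) h
  · rintro ⟨a, b⟩ _
    rw [coeff_expand_mul, coeff_heckeU]

lemma hecke_sq (p : ℕ) (hp : Odd p) (f : PowerSeries (ZMod 2)) :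
    hecke p (f ^ 2) = hecke p f ^ 2 := by
  have hp0 : p ≠ 0 := hp.pos.ne'
  rw [sq_eq_expand (hecke p f), sq_eq_expand f, hecke_eq p hp0, hecke_eq p hp0, map_add]
  congr 1
  · ext n
    rw [coeff_heckeU, coeff_expand, coeff_expand]
    by_cases h : 2 ∣ n
    · obtain ⟨m, rfl⟩ := h
      rw [if_pos ⟨p * m, by ring⟩, if_pos ⟨m, rfl⟩, coeff_heckeU, mul_left_comm,
        Nat.mul_div_cancel_left _ two_pos, Nat.mul_div_cancel_left _ two_pos]
    · rw [if_neg h, if_neg]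
      intro h'
      exact h ((Nat.prime_two.dvd_mul.mp h').resolve_left fun h2 =>
        (Nat.not_even_iff_odd.mpr hp) (even_iff_two_dvd.mpr h2))
  · rw [← expand_mul, ← expand_mul]
    simp only [mul_comm]

lemma hecke_one (p : ℕ) (hp : p ≠ 0) : hecke p 1 = 0 := by
  have := charP_two
  rw [hecke_eq p hp]
  have h : heckeU p 1 = 1 := by
    ext n
    rw [coeff_heckeU, coeff_one, coeff_one]
    simp [hp]
  rw [h, map_one]
  exact CharTwo.add_self_eq_zero 1

/-- An odd square divisible by `p` is `p ^ 2` times an odd square, so the two contributions agree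
and cancel. -/
lemma hecke_delta (p : ℕ) (hp : p.Prime) (h2 : Odd p) : hecke p delta = 0 := by
  classical
  ext n
  rw [coeff_hecke, map_zero]
  split_ifs with h
  · obtain ⟨m, rfl⟩ := h
    rw [Nat.mul_div_cancel_left _ hp.pos, coeff_delta, coeff_delta]
    have key : (∃ k, p * (p * m) = (2 * k + 1) ^ 2) ↔ ∃ k, m = (2 * k + 1) ^ 2 := by
      constructor
      · rintro ⟨k, hk⟩
        obtain ⟨t, ht⟩ : p ∣ 2 * k + 1 := hp.dvd_of_dvd_pow ⟨_, hk.symm⟩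
        have hm : m = t ^ 2 := by
          rw [ht] at hk
          have : p ^ 2 * m = p ^ 2 * t ^ 2 := by linarith [mul_pow p t 2, hk]
          exact Nat.eq_of_mul_eq_mul_left (pow_pos hp.pos 2) this
        have hodd : Odd (p * t) := ht ▸ odd_two_mul_add_one k
        obtain ⟨s, rfl⟩ := (Nat.odd_mul.mp hodd).2
        exact ⟨s, hm⟩
      · rintro ⟨k, rfl⟩
        obtain ⟨s, hs⟩ := h2.mul (odd_two_mul_add_one k)
        exact ⟨s, by rw [← hs]; ring⟩
    simp only [key]
    split_ifs <;> decide
  · rw [coeff_delta, if_neg]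
    rintro ⟨k, hk⟩
    obtain ⟨t, ht⟩ : p ∣ 2 * k + 1 := hp.dvd_of_dvd_pow ⟨_, hk.symm⟩
    rw [ht] at hk
    exact h ⟨t ^ 2, Nat.eq_of_mul_eq_mul_left hp.pos (by rw [hk]; ring)⟩

/-- With `B = A(q ^ 3)`, the equation lets `A ^ 4 f` be written through `B` and `B ^ 4`, which `U_3`
turns into `A` and `A ^ 4`. The `expand` part of `T_3` obeys the same recurrence because the
equation is symmetric in `A` and `B`. -/
lemma hecke_three_mul (A f : PowerSeries (ZMod 2)) (h3 : (3 : ℕ) ≠ 0)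
    (key : A ^ 4 + expand 3 h3 A ^ 4 = A * expand 3 h3 A) :
    hecke 3 (A ^ 4 * f) = A * hecke 3 (A * f) + A ^ 4 * hecke 3 f := by
  have := charP_two
  have h2 : (2 : PowerSeries (ZMod 2)) = 0 := CharTwo.two_eq_zero
  have hA : A ^ 4 * f = expand 3 h3 A * (A * f) + expand 3 h3 (A ^ 4) * f := by
    rw [map_pow]
    linear_combination f * key - f * expand 3 h3 A ^ 4 * h2
  have hU : heckeU 3 (A ^ 4 * f) = A * heckeU 3 (A * f) + A ^ 4 * heckeU 3 f := by
    rw [hA, map_add, heckeU_expand_mul, heckeU_expand_mul]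
  simp only [hecke_eq 3 h3, map_mul, map_pow, hU]
  linear_combination expand 3 h3 f * key - expand 3 h3 f * A ^ 4 * h2

lemma hecke_three_pow_mul (j : ℕ) (f : PowerSeries (ZMod 2)) :
    hecke 3 ((delta ^ 2 ^ j) ^ 4 * f) =
      delta ^ 2 ^ j * hecke 3 (delta ^ 2 ^ j * f) + (delta ^ 2 ^ j) ^ 4 * hecke 3 f := by
  have := charP_two
  have h3 : (3 : ℕ) ≠ 0 := three_ne_zero
  have h : (_ : PowerSeries (ZMod 2)) ^ 2 ^ j = _ ^ 2 ^ j :=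
    congrArg (· ^ 2 ^ j) (modularEquation_three h3)
  rw [add_pow_char_pow, mul_pow, pow_right_comm, pow_right_comm (expand 3 h3 delta),
    ← map_pow] at h
  exact hecke_three_mul _ _ h3 h

/-- A consequence of the modular equation is used instead of the equation itself, so that the terms
`A ^ 4 T(A ^ 4 f) + A ^ 16 T f` imitate the recurrence of `T_3` for `A ^ 4`, while the two other
terms will have smaller weight. -/
lemma hecke_five_mul (A f : PowerSeries (ZMod 2)) (h5 : (5 : ℕ) ≠ 0)
    (key : (A + expand 5 h5 A) ^ 6 = A * expand 5 h5 A) :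
    hecke 5 (A ^ 16 * f) = A ^ 4 * hecke 5 (A ^ 4 * f) + A ^ 3 * hecke 5 (A * f) +
      A ^ 8 * hecke 5 f + A ^ 16 * hecke 5 f := by
  have := charP_two
  have h2 : (2 : PowerSeries (ZMod 2)) = 0 := CharTwo.two_eq_zero
  set B := expand 5 h5 A with hB
  have e6 : (A + B) ^ 6 = A ^ 6 + A ^ 4 * B ^ 2 + A ^ 2 * B ^ 4 + B ^ 6 := by
    linear_combination (3 * A ^ 5 * B + 7 * A ^ 4 * B ^ 2 + 10 * A ^ 3 * B ^ 3 +
      7 * A ^ 2 * B ^ 4 + 3 * A * B ^ 5) * h2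
  have e8 : (A + B) ^ 8 = A ^ 8 + B ^ 8 := add_pow_char_pow (p := 2) (n := 3) A B
  have e16 : (A + B) ^ 16 = A ^ 16 + B ^ 16 := add_pow_char_pow (p := 2) (n := 4) A B
  have e2 : (A + B) ^ 2 = A ^ 2 + B ^ 2 := add_pow_char (p := 2) A B
  have e4 : (A + B) ^ 4 = A ^ 4 + B ^ 4 := add_pow_char_pow (p := 2) (n := 2) A B
  have k8 : A ^ 8 + B ^ 8 = A ^ 3 * B + A * B ^ 3 := by
    calc A ^ 8 + B ^ 8 = (A + B) ^ 6 * (A + B) ^ 2 := by rw [← e8]; ring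
      _ = _ := by rw [key, e2]; ring
  have k16 : A ^ 16 + B ^ 16 = A ^ 6 * B ^ 2 + A ^ 2 * B ^ 6 := by
    calc A ^ 16 + B ^ 16 = ((A + B) ^ 6) ^ 2 * (A + B) ^ 4 := by rw [← e16]; ring
      _ = _ := by rw [key, e4]; ring
  have k6 := e6.symm.trans key
  -- Adding `B ^ 2` times the modular equation removes the terms `A ^ 6 B ^ 2` and `A ^ 2 B ^ 6`,
  -- leaving only the exponents `4`, `1` and `0` of `A` on the right.
  have rel : A ^ 16 + B ^ 16 = A ^ 4 * B ^ 4 + A * B ^ 3 + B ^ 8 := by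
    linear_combination k16 + B ^ 2 * k6 - (A ^ 4 * B ^ 4 + B ^ 8) * h2
  -- The mirror image of `rel`, needed for the `expand` part; the two right-hand sides agree by
  -- `k8`.
  have rel' : A ^ 16 + B ^ 16 = B ^ 4 * A ^ 4 + B * A ^ 3 + A ^ 8 := by
    linear_combination rel + k8 + (A * B ^ 3 - A ^ 8) * h2
  have hA : A ^ 16 * f = expand 5 h5 (A ^ 4) * (A ^ 4 * f) + expand 5 h5 (A ^ 3) * (A * f) +
      expand 5 h5 (A ^ 8) * f + expand 5 h5 (A ^ 16) * f := by
    simp only [map_pow, ← hB]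
    linear_combination f * rel - f * B ^ 16 * h2
  have hU : heckeU 5 (A ^ 16 * f) = A ^ 4 * heckeU 5 (A ^ 4 * f) + A ^ 3 * heckeU 5 (A * f) +
      A ^ 8 * heckeU 5 f + A ^ 16 * heckeU 5 f := by
    rw [hA]
    simp only [map_add, heckeU_expand_mul]
  simp only [hecke_eq 5 h5, map_mul, map_pow, hU, ← hB]
  linear_combination expand 5 h5 f * rel' - expand 5 h5 f * A ^ 16 * h2

lemma hecke_five_pow_mul (j : ℕ) (f : PowerSeries (ZMod 2)) :
    hecke 5 ((delta ^ 2 ^ j) ^ 16 * f) =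
      (delta ^ 2 ^ j) ^ 4 * hecke 5 ((delta ^ 2 ^ j) ^ 4 * f) +
      (delta ^ 2 ^ j) ^ 3 * hecke 5 (delta ^ 2 ^ j * f) +
      (delta ^ 2 ^ j) ^ 8 * hecke 5 f + (delta ^ 2 ^ j) ^ 16 * hecke 5 f := by
  have := charP_two
  have h5 : (5 : ℕ) ≠ 0 := by norm_num
  have h : (_ : PowerSeries (ZMod 2)) ^ 2 ^ j = _ ^ 2 ^ j :=
    congrArg (· ^ 2 ^ j) (modularEquation_five h5)
  rw [pow_right_comm, add_pow_char_pow, mul_pow, ← map_pow] at h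
  exact hecke_five_mul _ _ h5 h

/-- The recurrence given by the modular equation itself, short enough to compute small powers. -/
lemma hecke_five_mul_six (A f : PowerSeries (ZMod 2)) (h5 : (5 : ℕ) ≠ 0)
    (key : (A + expand 5 h5 A) ^ 6 = A * expand 5 h5 A) :
    hecke 5 (A ^ 6 * f) = A * hecke 5 (A * f) + A ^ 2 * hecke 5 (A ^ 4 * f) +
      A ^ 4 * hecke 5 (A ^ 2 * f) + A ^ 6 * hecke 5 f := by
  have := charP_two
  have h2 : (2 : PowerSeries (ZMod 2)) = 0 := CharTwo.two_eq_zero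
  set B := expand 5 h5 A with hB
  have hA : A ^ 6 * f = expand 5 h5 A * (A * f) + expand 5 h5 (A ^ 2) * (A ^ 4 * f) +
      expand 5 h5 (A ^ 4) * (A ^ 2 * f) + expand 5 h5 (A ^ 6) * f := by
    simp only [map_pow, ← hB]
    linear_combination f * key - f * (3 * A ^ 5 * B + 8 * A ^ 4 * B ^ 2 + 10 * A ^ 3 * B ^ 3 +
      8 * A ^ 2 * B ^ 4 + 3 * A * B ^ 5 + B ^ 6) * h2
  have hU : heckeU 5 (A ^ 6 * f) = A * heckeU 5 (A * f) + A ^ 2 * heckeU 5 (A ^ 4 * f) +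
      A ^ 4 * heckeU 5 (A ^ 2 * f) + A ^ 6 * heckeU 5 f := by
    rw [hA]
    simp only [map_add, heckeU_expand_mul]
  simp only [hecke_eq 5 h5, map_mul, map_pow, hU, ← hB]
  linear_combination expand 5 h5 f * key - expand 5 h5 f * (3 * A ^ 5 * B + 8 * A ^ 4 * B ^ 2 +
    10 * A ^ 3 * B ^ 3 + 8 * A ^ 2 * B ^ 4 + 3 * A * B ^ 5 + A ^ 6) * h2

lemma hecke_five_add_six (l : ℕ) : hecke 5 (delta ^ (l + 6)) =
    delta * hecke 5 (delta ^ (l + 1)) + delta ^ 2 * hecke 5 (delta ^ (l + 4)) +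
      delta ^ 4 * hecke 5 (delta ^ (l + 2)) + delta ^ 6 * hecke 5 (delta ^ l) := by
  have := hecke_five_mul_six delta (delta ^ l) (by norm_num) (modularEquation_five _)
  simp only [← pow_add, ← pow_succ'] at this
  rw [add_comm l 6, this, add_comm l 4, add_comm l 2]

lemma hecke_three_add_four (l : ℕ) : hecke 3 (delta ^ (l + 4)) =
    delta * hecke 3 (delta ^ (l + 1)) + delta ^ 4 * hecke 3 (delta ^ l) := by
  have := hecke_three_mul delta (delta ^ l) (by norm_num) (modularEquation_three _)
  simp only [← pow_add, ← pow_succ'] at this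
  rw [add_comm l 4, this]

/-! ### Nonvanishing and values at the first powers of `Δ`. -/

lemma hecke_pow_mul_two (p : ℕ) (hp : Odd p) (k : ℕ) :
    hecke p (delta ^ (k * 2)) = hecke p (delta ^ k) ^ 2 := by
  rw [pow_mul, hecke_sq p hp]

lemma exists_delta_eq : ∃ u : PowerSeries (ZMod 2), constantCoeff u = 1 ∧ delta = X * u := by
  classical
  refine ⟨PowerSeries.mk fun n => coeff (n + 1) delta, ?_, ?_⟩
  · rw [← coeff_zero_eq_constantCoeff_apply, coeff_mk, coeff_delta, if_pos ⟨0, rfl⟩]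
  · ext n
    rcases n with _ | n
    · rw [coeff_zero_X_mul, coeff_delta, if_neg]
      rintro ⟨m, hm⟩
      exact absurd hm.symm (by positivity)
    · rw [coeff_succ_X_mul, coeff_mk]

lemma coeff_delta_pow_self (k : ℕ) : coeff k (delta ^ k) = 1 := by
  obtain ⟨u, hu, h⟩ := exists_delta_eq
  rw [h, mul_pow, coeff_X_pow_mul', if_pos le_rfl, Nat.sub_self,
    coeff_zero_eq_constantCoeff_apply, map_pow, hu, one_pow]

lemma hecke_delta_pow_ne_zero (p : ℕ) (hp : p ≠ 1) : hecke p (delta ^ p) ≠ 0 := by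
  intro h
  have h1 := coeff_hecke p 1 (delta ^ p)
  rw [h, if_neg (by rwa [Nat.dvd_one]), mul_one, coeff_delta_pow_self] at h1
  simp at h1

/-- For `y = T_3 (Δ ^ 3)`, squaring gives `T_3 (Δ ^ 6) = y ^ 2` and the recurrence gives `Δ y`.
Since `y ≠ 0`, it can be cancelled. The value of `T_5 (Δ ^ 5)` is found in the same way from `Δ ^
10`. -/
lemma hecke_three_pow_three : hecke 3 (delta ^ 3) = delta := by
  have h3 : Odd 3 := by decide
  have h1 := hecke_delta 3 Nat.prime_three h3
  have h2 := hecke_pow_mul_two 3 h3 1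
  have h6 := hecke_pow_mul_two 3 h3 3
  have h := hecke_three_add_four 2
  norm_num [h1] at h2 h6 h
  rw [h6, h2, mul_zero, add_zero, sq] at h
  exact mul_right_cancel₀ (hecke_delta_pow_ne_zero 3 (by norm_num)) h

lemma hecke_five_pow_three : hecke 5 (delta ^ 3) = 0 := by
  have h5 : Odd 5 := by decide
  have h0 := hecke_one 5 (by norm_num)
  have h1 := hecke_delta 5 Nat.prime_five h5
  have h2 := hecke_pow_mul_two 5 h5 1
  have h4 := hecke_pow_mul_two 5 h5 2
  have h6 := hecke_pow_mul_two 5 h5 3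
  have h := hecke_five_add_six 0
  norm_num [h0, h1] at h2 h4 h6 h
  rw [h2] at h4 h
  norm_num at h4
  rw [h6, h4] at h
  simpa using h

lemma hecke_five_pow_five : hecke 5 (delta ^ 5) = delta := by
  have h5 : Odd 5 := by decide
  have h1 := hecke_delta 5 Nat.prime_five h5
  have h2 := hecke_pow_mul_two 5 h5 1
  have h4 := hecke_pow_mul_two 5 h5 2
  have h6 := hecke_pow_mul_two 5 h5 3
  have h8 := hecke_pow_mul_two 5 h5 4
  have h10 := hecke_pow_mul_two 5 h5 5
  have h := hecke_five_add_six 4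
  norm_num [h1, hecke_five_pow_three] at h2 h4 h6 h8 h10 h
  rw [h2] at h4
  norm_num at h4
  rw [h4] at h8 h
  norm_num at h8
  rw [h10, h8, h6, mul_zero, add_zero, mul_zero, mul_zero, add_zero, add_zero, sq] at h
  exact mul_right_cancel₀ (hecke_delta_pow_ne_zero 5 (by norm_num)) h

/-! ### Codes of exponents -/

/-- The number whose digits in base `4` are the binary digits of `a`. -/
def spread (a : ℕ) : ℕ := Nat.ofDigits 4 (Nat.digits 2 a)

lemma spread_zero : spread 0 = 0 := by simp [spread]

lemma spread_two_mul_add (a r : ℕ) (hr : r < 2) : spread (2 * a + r) = 4 * spread a + r := by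
  by_cases h : 2 * a + r = 0
  · obtain ⟨rfl, rfl⟩ : a = 0 ∧ r = 0 := by omega
    simp [spread]
  · rw [spread, Nat.digits_def' one_lt_two (Nat.pos_of_ne_zero h), Nat.ofDigits_cons,
      show (2 * a + r) % 2 = r by omega, show (2 * a + r) / 2 = a by omega, spread]
    exact add_comm _ _

lemma spread_add_two_pow (i a : ℕ) (h : a / 2 ^ i % 2 = 0) :
    spread (a + 2 ^ i) = spread a + 4 ^ i := by
  induction i generalizing a with
  | zero =>
    rw [pow_zero, Nat.div_one] at h
    have h1 := spread_two_mul_add (a / 2) 0 two_pos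
    have h2 := spread_two_mul_add (a / 2) 1 one_lt_two
    rw [show 2 * (a / 2) + 0 = a by omega] at h1
    rw [show 2 * (a / 2) + 1 = a + 1 by omega] at h2
    rw [pow_zero, pow_zero, h2, h1, add_zero]
  | succ i ih =>
    have hr : a % 2 < 2 := Nat.mod_lt _ two_pos
    have h1 := spread_two_mul_add (a / 2) (a % 2) hr
    have h2 := spread_two_mul_add (a / 2 + 2 ^ i) (a % 2) hr
    rw [show 2 * (a / 2) + a % 2 = a by omega] at h1
    rw [show 2 * (a / 2 + 2 ^ i) + a % 2 = a + 2 ^ (i + 1) by rw [pow_succ]; omega,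
      ih _ (by rwa [Nat.div_div_eq_div_mul, ← pow_succ'])] at h2
    rw [h2, h1, pow_succ]; ring

/-- The odd exponent with code `(a, b)`: its binary digits, after the last one, are alternately
those of `a` and those of `b`. -/
def expo (a b : ℕ) : ℕ := 2 * (spread a + 2 * spread b) + 1

lemma expo_injective {a b c d : ℕ} (h : expo a b = expo c d) : a = c ∧ b = d := by
  induction hn : a + b + c + d using Nat.strong_induction_on generalizing a b c d with
  | _ n ih =>
    subst hn
    by_cases h0 : a + b + c + d = 0
    · omega
    · have e : ∀ a, spread a = 4 * spread (a / 2) + a % 2 := fun a => by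
        rw [← spread_two_mul_add _ _ (Nat.mod_lt _ two_pos), Nat.div_add_mod]
      unfold expo at h
      rw [e a, e b, e c, e d] at h
      have := ih (a / 2 + b / 2 + c / 2 + d / 2) (by omega) (a := a / 2) (b := b / 2) (c := c / 2)
        (d := d / 2) (by unfold expo; omega) rfl
      omega

lemma exists_expo (k : ℕ) : ∃ a b, expo a b = 2 * k + 1 := by
  induction k using Nat.strong_induction_on with
  | _ k ih =>
    by_cases h0 : k = 0
    · exact ⟨0, 0, by simp [expo, spread_zero, h0]⟩
    · obtain ⟨a, b, h⟩ := ih (k / 4) (by omega)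
      refine ⟨2 * a + k % 2, 2 * b + k % 4 / 2, ?_⟩
      unfold expo at h ⊢
      rw [spread_two_mul_add _ _ (by omega), spread_two_mul_add _ _ (by omega)]
      omega

lemma expo_add_left (i a b : ℕ) (h : a / 2 ^ i % 2 = 0) :
    expo (a + 2 ^ i) b = expo a b + 2 * 4 ^ i := by
  rw [expo, spread_add_two_pow i a h, expo]; ring

lemma expo_add_right (i a b : ℕ) (h : b / 2 ^ i % 2 = 0) :
    expo a (b + 2 ^ i) = expo a b + 4 * 4 ^ i := by
  rw [expo, spread_add_two_pow i b h, expo]; ring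

lemma exists_eq_add_two_pow (i a : ℕ) (h : a / 2 ^ i % 2 = 1) :
    ∃ c, a = c + 2 ^ i ∧ c / 2 ^ i % 2 = 0 := by
  have hpos : 0 < 2 ^ i := by positivity
  have hle : 2 ^ i ≤ a := by
    by_contra hlt
    rw [Nat.div_eq_of_lt (by omega)] at h
    omega
  refine ⟨a - 2 ^ i, by omega, ?_⟩
  have : (a - 2 ^ i + 2 ^ i) / 2 ^ i = (a - 2 ^ i) / 2 ^ i + 1 := Nat.add_div_right _ hpos
  rw [Nat.sub_add_cancel hle] at this
  omega

/-- Adding a power of two to an exponent increases the weight `2 a + 3 b` of its code by at most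
the weight of that power, and by less if there is a carry. -/
lemma exists_expo_add (a b i : ℕ) :
    (∃ c d, expo c d = expo a b + 2 * 4 ^ i ∧ 2 * c + 3 * d ≤ 2 * a + 3 * b + 2 * 2 ^ i ∧
      (a / 2 ^ i % 2 = 1 → 2 * c + 3 * d < 2 * a + 3 * b + 2 * 2 ^ i)) ∧
    (∃ c d, expo c d = expo a b + 4 * 4 ^ i ∧ 2 * c + 3 * d ≤ 2 * a + 3 * b + 3 * 2 ^ i ∧
      (b / 2 ^ i % 2 = 1 → 2 * c + 3 * d < 2 * a + 3 * b + 3 * 2 ^ i)) := by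
  induction hn : a + b using Nat.strong_induction_on generalizing a b i with
  | _ n ih =>
    subst hn
    have hpos : 0 < 2 ^ i := by positivity
    constructor
    · rcases Nat.mod_two_eq_zero_or_one (a / 2 ^ i) with h | h
      · exact ⟨a + 2 ^ i, b, expo_add_left i a b h, by omega, by omega⟩
      · obtain ⟨c, rfl, hc⟩ := exists_eq_add_two_pow i a h
        obtain ⟨x, y, h1, h2, -⟩ := (ih (c + b) (by omega) c b i rfl).2
        refine ⟨x, y, ?_, by omega, by omega⟩
        rw [h1, expo_add_left i c b hc]; ring
    · rcases Nat.mod_two_eq_zero_or_one (b / 2 ^ i) with h | h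
      · exact ⟨a, b + 2 ^ i, expo_add_right i a b h, by omega, by omega⟩
      · obtain ⟨c, rfl, hc⟩ := exists_eq_add_two_pow i b h
        obtain ⟨x, y, h1, h2, -⟩ := (ih (a + c) (by omega) a c (i + 1) rfl).1
        rw [pow_succ] at h2
        refine ⟨x, y, ?_, by omega, by omega⟩
        rw [h1, expo_add_right i a c hc, pow_succ]; ring

/-! ### The weight filtration -/

/-- The power of `Δ` whose exponent has code `(a, b)`. -/
noncomputable def codePow (a b : ℕ) : PowerSeries (ZMod 2) := delta ^ expo a b

/-- The span of the odd powers of `Δ` of weight less than `n`. -/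
noncomputable def lower (n : ℕ) : Submodule (ZMod 2) (PowerSeries (ZMod 2)) :=
  Submodule.span (ZMod 2) {f | ∃ a b, 2 * a + 3 * b < n ∧ codePow a b = f}

lemma codePow_mem_lower {a b n : ℕ} (h : 2 * a + 3 * b < n) : codePow a b ∈ lower n :=
  Submodule.subset_span ⟨a, b, h, rfl⟩

lemma lower_mono {m n : ℕ} (h : m ≤ n) : lower m ≤ lower n :=
  Submodule.span_mono fun _ ⟨a, b, h1, h2⟩ => ⟨a, b, by omega, h2⟩

lemma lower_zero : lower 0 = ⊥ := by
  rw [lower, Submodule.span_eq_bot]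
  rintro f ⟨a, b, h, -⟩
  omega

/-- The power of `Δ` by which multiplication adds `2 ^ i` to the first half of a code. -/
noncomputable def leftPow (i : ℕ) : PowerSeries (ZMod 2) := delta ^ (2 * 4 ^ i)

/-- The power of `Δ` by which multiplication adds `2 ^ i` to the second half of a code. -/
noncomputable def rightPow (i : ℕ) : PowerSeries (ZMod 2) := delta ^ (4 * 4 ^ i)

lemma leftPow_mul_codePow {i a b : ℕ} (h : a / 2 ^ i % 2 = 0) :
    leftPow i * codePow a b = codePow (a + 2 ^ i) b := by
  rw [leftPow, codePow, codePow, ← pow_add, expo_add_left i a b h, add_comm]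

lemma rightPow_mul_codePow {i a b : ℕ} (h : b / 2 ^ i % 2 = 0) :
    rightPow i * codePow a b = codePow a (b + 2 ^ i) := by
  rw [rightPow, codePow, codePow, ← pow_add, expo_add_right i a b h, add_comm]

lemma exists_leftPow_mul (i a b : ℕ) : ∃ c d, leftPow i * codePow a b = codePow c d ∧
    expo c d = expo a b + 2 * 4 ^ i ∧ 2 * c + 3 * d ≤ 2 * a + 3 * b + 2 * 2 ^ i ∧
      (a / 2 ^ i % 2 = 1 → 2 * c + 3 * d < 2 * a + 3 * b + 2 * 2 ^ i) := by
  obtain ⟨c, d, h, h'⟩ := (exists_expo_add a b i).1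
  exact ⟨c, d, by rw [leftPow, codePow, codePow, ← pow_add, h, add_comm], h, h'⟩

lemma exists_rightPow_mul (i a b : ℕ) : ∃ c d, rightPow i * codePow a b = codePow c d ∧
    expo c d = expo a b + 4 * 4 ^ i ∧ 2 * c + 3 * d ≤ 2 * a + 3 * b + 3 * 2 ^ i ∧
      (b / 2 ^ i % 2 = 1 → 2 * c + 3 * d < 2 * a + 3 * b + 3 * 2 ^ i) := by
  obtain ⟨c, d, h, h'⟩ := (exists_expo_add a b i).2
  exact ⟨c, d, by rw [rightPow, codePow, codePow, ← pow_add, h, add_comm], h, h'⟩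

lemma mul_mem_lower {g f : PowerSeries (ZMod 2)} {w n c : ℕ}
    (hg : ∀ a b, g * codePow a b ∈ lower (2 * a + 3 * b + w + 1)) (hf : f ∈ lower (n - c)) :
    g * f ∈ lower (n + w - c) := by
  -- Truncated subtraction is harmless: when `n < c` the hypothesis says `f = 0`.
  rcases Nat.lt_or_ge n c with h | h
  · rw [show n - c = 0 by omega, lower_zero, Submodule.mem_bot] at hf
    rw [hf, mul_zero]
    exact zero_mem _
  · have : lower (n - c) ≤ (lower (n + w - c)).comap (LinearMap.mulLeft (ZMod 2) g) := by
      rw [lower, Submodule.span_le]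
      rintro _ ⟨a, b, h1, rfl⟩
      exact lower_mono (by omega) (hg a b)
    exact this hf

lemma leftPow_mul_mem {i n c : ℕ} {f : PowerSeries (ZMod 2)} (hf : f ∈ lower (n - c)) :
    leftPow i * f ∈ lower (n + 2 * 2 ^ i - c) := by
  refine mul_mem_lower (fun a b => ?_) hf
  obtain ⟨x, y, h, -, h', -⟩ := exists_leftPow_mul i a b
  rw [h]
  exact codePow_mem_lower (by omega)

lemma rightPow_mul_mem {i n c : ℕ} {f : PowerSeries (ZMod 2)} (hf : f ∈ lower (n - c)) :
    rightPow i * f ∈ lower (n + 3 * 2 ^ i - c) := by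
  refine mul_mem_lower (fun a b => ?_) hf
  obtain ⟨x, y, h, -, h', -⟩ := exists_rightPow_mul i a b
  rw [h]
  exact codePow_mem_lower (by omega)

/-! ### The recurrences of `T_3` and `T_5` in terms of codes. -/

lemma leftPow_eq (i : ℕ) : leftPow i = delta ^ 2 ^ (2 * i + 1) := by
  rw [leftPow, pow_succ, pow_mul 2]; norm_num [mul_comm]

lemma rightPow_eq (i : ℕ) : rightPow i = delta ^ 2 ^ (2 * i + 2) := by
  rw [rightPow, pow_add, pow_mul 2]; norm_num [mul_comm]

lemma leftPow_succ (i : ℕ) : leftPow (i + 1) = leftPow i ^ 4 := by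
  rw [leftPow, leftPow, ← pow_mul]; congr 1; ring

lemma rightPow_succ (i : ℕ) : rightPow (i + 1) = rightPow i ^ 4 := by
  rw [rightPow, rightPow, ← pow_mul]; congr 1; ring

lemma rightPow_eq_sq (i : ℕ) : rightPow i = leftPow i ^ 2 := by
  rw [rightPow, leftPow, ← pow_mul]; congr 1; ring

lemma leftPow_succ_eq_sq (i : ℕ) : leftPow (i + 1) = rightPow i ^ 2 := by
  rw [rightPow, leftPow, ← pow_mul]; congr 1; ring

lemma hecke_three_leftPow_mul (i : ℕ) (f : PowerSeries (ZMod 2)) :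
    hecke 3 (leftPow (i + 1) * f) =
      leftPow i * hecke 3 (leftPow i * f) + leftPow (i + 1) * hecke 3 f := by
  rw [leftPow_succ, leftPow_eq]
  exact hecke_three_pow_mul _ f

lemma hecke_three_rightPow_mul (i : ℕ) (f : PowerSeries (ZMod 2)) :
    hecke 3 (rightPow (i + 1) * f) =
      rightPow i * hecke 3 (rightPow i * f) + rightPow (i + 1) * hecke 3 f := by
  rw [rightPow_succ, rightPow_eq]
  exact hecke_three_pow_mul _ f

lemma hecke_five_leftPow_mul (i : ℕ) (f : PowerSeries (ZMod 2)) :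
    hecke 5 (leftPow (i + 2) * f) =
      leftPow (i + 1) * hecke 5 (leftPow (i + 1) * f) + leftPow (i + 2) * hecke 5 f +
        (leftPow i * (rightPow i * hecke 5 (leftPow i * f)) + rightPow (i + 1) * hecke 5 f) := by
  rw [leftPow_succ, rightPow_eq_sq, rightPow_eq_sq, leftPow_succ, leftPow_eq]
  have := hecke_five_pow_mul (2 * i + 1) f
  simp only [← pow_mul] at this ⊢
  norm_num [mul_assoc] at this ⊢
  rw [this]; ring

lemma hecke_five_rightPow_mul (i : ℕ) (f : PowerSeries (ZMod 2)) :
    hecke 5 (rightPow (i + 2) * f) =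
      rightPow (i + 1) * hecke 5 (rightPow (i + 1) * f) + rightPow (i + 2) * hecke 5 f +
        (rightPow i * (leftPow (i + 1) * hecke 5 (rightPow i * f)) +
          leftPow (i + 2) * hecke 5 f) := by
  rw [rightPow_succ, leftPow_succ_eq_sq, leftPow_succ_eq_sq, rightPow_succ, rightPow_eq]
  have := hecke_five_pow_mul (2 * i + 2) f
  simp only [← pow_mul] at this ⊢
  norm_num [mul_assoc] at this ⊢
  rw [this]; ring

/-- The power of `Δ` whose exponent has code `(a - 1, b)`, or zero when `a = 0`. -/
noncomputable def predLeft (a b : ℕ) : PowerSeries (ZMod 2) :=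
  if a = 0 then 0 else codePow (a - 1) b

/-- The power of `Δ` whose exponent has code `(a, b - 1)`, or zero when `b = 0`. -/
noncomputable def predRight (a b : ℕ) : PowerSeries (ZMod 2) :=
  if b = 0 then 0 else codePow a (b - 1)

lemma predLeft_zero (b : ℕ) : predLeft 0 b = 0 := if_pos rfl

lemma predRight_zero (a : ℕ) : predRight a 0 = 0 := if_pos rfl

lemma predLeft_succ (a b : ℕ) : predLeft (a + 1) b = codePow a b := if_neg (Nat.succ_ne_zero a)

lemma predRight_succ (a b : ℕ) : predRight a (b + 1) = codePow a b := if_neg (Nat.succ_ne_zero b)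

lemma predLeft_mem (a b : ℕ) : predLeft a b ∈ lower (2 * a + 3 * b - 1) := by
  rcases a with _ | a
  · rw [predLeft_zero]; exact zero_mem _
  · rw [predLeft_succ]; exact codePow_mem_lower (by omega)

lemma predRight_mem (a b : ℕ) : predRight a b ∈ lower (2 * a + 3 * b - 2) := by
  rcases b with _ | b
  · rw [predRight_zero]; exact zero_mem _
  · rw [predRight_succ]; exact codePow_mem_lower (by omega)

lemma div_two_pow_mod_two_of_lt {i a : ℕ} (h : a < 2 ^ i) : a / 2 ^ i % 2 = 0 := by
  rw [Nat.div_eq_of_lt h]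

lemma add_div_two_pow_mod_two_of_lt {i a : ℕ} (h : a < 2 ^ i) : (a + 2 ^ i) / 2 ^ i % 2 = 1 := by
  rw [Nat.add_div_right _ (by positivity), Nat.div_eq_of_lt h]

lemma lt_or_bit {i a : ℕ} (h : a < 2 ^ (i + 1)) : a < 2 ^ i ∨ a / 2 ^ i % 2 = 1 := by
  rcases Nat.lt_or_ge a (2 ^ i) with h' | h'
  · exact Or.inl h'
  · right
    have h1 : 1 ≤ a / 2 ^ i := (Nat.one_le_div_iff (by positivity)).mpr h'
    have h2 : a / 2 ^ i < 2 := (Nat.div_lt_iff_lt_mul (by positivity)).mpr (by 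
      rw [← pow_succ']; exact h)
    omega

/-! ### Inductive steps for the leading terms of an operator. -/

section Induction

variable (T : PowerSeries (ZMod 2) →ₗ[ZMod 2] PowerSeries (ZMod 2))

/-- `T` lowers weights by `2`, its leading part being the decrement of the first half of codes. -/
def LowersLeft (a b : ℕ) : Prop := T (codePow a b) - predLeft a b ∈ lower (2 * a + 3 * b - 2)

/-- `T` lowers weights by `3`, its leading part being the decrement of the second half of codes. -/
def LowersRight (a b : ℕ) : Prop := T (codePow a b) - predRight a b ∈ lower (2 * a + 3 * b - 3)

variable {T}

lemma LowersLeft.mem {a b : ℕ} (h : LowersLeft T a b) :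
    T (codePow a b) ∈ lower (2 * a + 3 * b - 1) := by
  rw [← sub_add_cancel (T (codePow a b)) (predLeft a b)]
  exact add_mem (lower_mono (by omega) h) (predLeft_mem a b)

lemma LowersRight.mem {a b : ℕ} (h : LowersRight T a b) :
    T (codePow a b) ∈ lower (2 * a + 3 * b - 2) := by
  rw [← sub_add_cancel (T (codePow a b)) (predRight a b)]
  exact add_mem (lower_mono (by omega) h) (predRight_mem a b)

/-- This adds a new top bit to `a`. Exactly one of the first two terms of `hT` supplies the leading
term; the other loses weight, through a carry or because `predLeft` vanishes. The remainder `r` is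
zero for `T_3`; the counterpart for `T_5` needs it. -/
lemma LowersLeft.add_left {i a b : ℕ} {r : PowerSeries (ZMod 2)} (ha : a < 2 ^ (i + 1))
    (ih : ∀ c d, expo c d < expo (a + 2 ^ (i + 1)) b → LowersLeft T c d)
    (hr : r ∈ lower (2 * a + 3 * b + 4 * 2 ^ i - 2))
    (hT : T (leftPow (i + 1) * codePow a b) = leftPow i * T (leftPow i * codePow a b) +
      leftPow (i + 1) * T (codePow a b) + r) : LowersLeft T (a + 2 ^ (i + 1)) b := by
  have hpos : 0 < 2 ^ i := by positivity
  have hpos4 : 0 < 4 ^ i := by positivity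
  have he := expo_add_left (i + 1) a b (div_two_pow_mod_two_of_lt ha)
  rw [pow_succ 4] at he
  have h0 := leftPow_mul_mem (i := i + 1) (ih a b (by omega))
  rw [leftPow_mul_codePow (div_two_pow_mod_two_of_lt ha)] at hT
  rw [LowersLeft, hT]
  have e2 : 2 ^ (i + 1) = 2 * 2 ^ i := pow_succ' _ _
  rcases lt_or_bit ha with h | h
  · have e1 := expo_add_left i a b (div_two_pow_mod_two_of_lt h)
    have h1 := leftPow_mul_mem (i := i) (ih (a + 2 ^ i) b (by omega))
    rw [leftPow_mul_codePow (div_two_pow_mod_two_of_lt h)]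
    rcases a with _ | a
    · have h2 : leftPow i * predLeft (0 + 2 ^ i) b = predLeft (0 + 2 ^ (i + 1)) b := by
        obtain ⟨c, hc⟩ : ∃ c, 2 ^ i = c + 1 := ⟨2 ^ i - 1, by omega⟩
        rw [zero_add, hc, predLeft_succ, leftPow_mul_codePow (div_two_pow_mod_two_of_lt (by omega)),
          show 0 + 2 ^ (i + 1) = c + 2 ^ i + 1 by omega, predLeft_succ]
      rw [predLeft_zero, sub_zero] at h0
      rw [mul_sub, h2] at h1
      rw [add_assoc, add_sub_right_comm]
      exact add_mem (lower_mono (by omega) h1)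
        (add_mem (lower_mono (by omega) h0) (lower_mono (by omega) hr))
    · rw [show a + 1 + 2 ^ i = a + 2 ^ i + 1 by omega] at h1 ⊢
      rw [predLeft_succ, mul_sub] at h1
      -- For positive first half the decrement keeps bit `i`, so multiplying again by `leftPow i`
      -- carries; the leading term is that of the second summand.
      obtain ⟨c, d, h2, -, -, h3⟩ := exists_leftPow_mul i (a + 2 ^ i) b
      replace h3 := h3 (add_div_two_pow_mod_two_of_lt (by omega))
      rw [h2] at h1
      have h4 : leftPow (i + 1) * predLeft (a + 1) b = predLeft (a + 1 + 2 ^ (i + 1)) b := by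
        rw [predLeft_succ, leftPow_mul_codePow (div_two_pow_mod_two_of_lt (by omega)),
          show a + 1 + 2 ^ (i + 1) = a + 2 ^ (i + 1) + 1 by omega, predLeft_succ]
      rw [mul_sub, h4] at h0
      have h5 : codePow c d ∈ lower (2 * (a + 1 + 2 ^ (i + 1)) + 3 * b - 2) :=
        codePow_mem_lower (by omega)
      have : _ ∈ lower (2 * (a + 1 + 2 ^ (i + 1)) + 3 * b - 2) :=
        add_mem (add_mem (add_mem (lower_mono (by omega) h1) h5) (lower_mono (by omega) h0))
          (lower_mono (by omega) hr)
      convert this using 1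
      ring
  -- Bit `i` is already set: the carry occurs inside `T`, before the decrement.
  · obtain ⟨c, d, h2, h2', -, h3⟩ := exists_leftPow_mul i a b
    replace h3 := h3 h
    have h1 := leftPow_mul_mem (i := i) (ih c d (by omega)).mem
    rw [h2]
    rcases a with _ | a
    · simp at h
    · have h4 : leftPow (i + 1) * predLeft (a + 1) b = predLeft (a + 1 + 2 ^ (i + 1)) b := by
        rw [predLeft_succ, leftPow_mul_codePow (div_two_pow_mod_two_of_lt (by omega)),
          show a + 1 + 2 ^ (i + 1) = a + 2 ^ (i + 1) + 1 by omega, predLeft_succ]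
      rw [mul_sub, h4] at h0
      have : _ ∈ lower (2 * (a + 1 + 2 ^ (i + 1)) + 3 * b - 2) :=
        add_mem (add_mem (lower_mono (by omega) h1) (lower_mono (by omega) h0))
          (lower_mono (by omega) hr)
      convert this using 1
      ring

lemma leftPow_mul_predRight {i a b : ℕ} (h : a / 2 ^ i % 2 = 0) :
    leftPow i * predRight a b = predRight (a + 2 ^ i) b := by
  rcases b with _ | b
  · rw [predRight_zero, predRight_zero, mul_zero]
  · rw [predRight_succ, predRight_succ, leftPow_mul_codePow h]

lemma rightPow_mul_predLeft {i a b : ℕ} (h : b / 2 ^ i % 2 = 0) :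
    rightPow i * predLeft a b = predLeft a (b + 2 ^ i) := by
  rcases a with _ | a
  · rw [predLeft_zero, predLeft_zero, mul_zero]
  · rw [predLeft_succ, predLeft_succ, rightPow_mul_codePow h]

lemma LowersRight.add_right {i a b : ℕ} {r : PowerSeries (ZMod 2)} (hb : b < 2 ^ (i + 1))
    (ih : ∀ c d, expo c d < expo a (b + 2 ^ (i + 1)) → LowersRight T c d)
    (hr : r ∈ lower (2 * a + 3 * b + 6 * 2 ^ i - 3))
    (hT : T (rightPow (i + 1) * codePow a b) = rightPow i * T (rightPow i * codePow a b) +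
      rightPow (i + 1) * T (codePow a b) + r) : LowersRight T a (b + 2 ^ (i + 1)) := by
  have hpos : 0 < 2 ^ i := by positivity
  have hpos4 : 0 < 4 ^ i := by positivity
  have he := expo_add_right (i + 1) a b (div_two_pow_mod_two_of_lt hb)
  rw [pow_succ 4] at he
  have h0 := rightPow_mul_mem (i := i + 1) (ih a b (by omega))
  rw [rightPow_mul_codePow (div_two_pow_mod_two_of_lt hb)] at hT
  rw [LowersRight, hT]
  have e2 : 2 ^ (i + 1) = 2 * 2 ^ i := pow_succ' _ _
  rcases lt_or_bit hb with h | h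
  · have e1 := expo_add_right i a b (div_two_pow_mod_two_of_lt h)
    have h1 := rightPow_mul_mem (i := i) (ih a (b + 2 ^ i) (by omega))
    rw [rightPow_mul_codePow (div_two_pow_mod_two_of_lt h)]
    rcases b with _ | b
    · have h2 : rightPow i * predRight a (0 + 2 ^ i) = predRight a (0 + 2 ^ (i + 1)) := by
        obtain ⟨c, hc⟩ : ∃ c, 2 ^ i = c + 1 := ⟨2 ^ i - 1, by omega⟩
        rw [zero_add, hc, predRight_succ,
          rightPow_mul_codePow (div_two_pow_mod_two_of_lt (by omega)),
          show 0 + 2 ^ (i + 1) = c + 2 ^ i + 1 by omega, predRight_succ]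
      rw [predRight_zero, sub_zero] at h0
      rw [mul_sub, h2] at h1
      rw [add_assoc, add_sub_right_comm]
      exact add_mem (lower_mono (by omega) h1)
        (add_mem (lower_mono (by omega) h0) (lower_mono (by omega) hr))
    · rw [show b + 1 + 2 ^ i = b + 2 ^ i + 1 by omega] at h1 ⊢
      rw [predRight_succ, mul_sub] at h1
      obtain ⟨c, d, h2, -, -, h3⟩ := exists_rightPow_mul i a (b + 2 ^ i)
      replace h3 := h3 (add_div_two_pow_mod_two_of_lt (by omega))
      rw [h2] at h1
      have h4 : rightPow (i + 1) * predRight a (b + 1) = predRight a (b + 1 + 2 ^ (i + 1)) := by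
        rw [predRight_succ, rightPow_mul_codePow (div_two_pow_mod_two_of_lt (by omega)),
          show b + 1 + 2 ^ (i + 1) = b + 2 ^ (i + 1) + 1 by omega, predRight_succ]
      rw [mul_sub, h4] at h0
      have h5 : codePow c d ∈ lower (2 * a + 3 * (b + 1 + 2 ^ (i + 1)) - 3) :=
        codePow_mem_lower (by omega)
      have := add_mem (add_mem (add_mem (lower_mono (by omega) h1) h5) (lower_mono (by omega) h0))
        (lower_mono (by omega) hr)
      convert this using 1
      ring
  · obtain ⟨c, d, h2, h2', -, h3⟩ := exists_rightPow_mul i a b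
    replace h3 := h3 h
    have h1 := rightPow_mul_mem (i := i) (ih c d (by omega)).mem
    rw [h2]
    rcases b with _ | b
    · simp at h
    · have h4 : rightPow (i + 1) * predRight a (b + 1) = predRight a (b + 1 + 2 ^ (i + 1)) := by
        rw [predRight_succ, rightPow_mul_codePow (div_two_pow_mod_two_of_lt (by omega)),
          show b + 1 + 2 ^ (i + 1) = b + 2 ^ (i + 1) + 1 by omega, predRight_succ]
      rw [mul_sub, h4] at h0
      have : _ ∈ lower (2 * a + 3 * (b + 1 + 2 ^ (i + 1)) - 3) := add_mem
        (add_mem (lower_mono (by omega) h1) (lower_mono (by omega) h0))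
        (lower_mono (by omega) hr)
      convert this using 1
      ring

/-- The new bit is in the half that is not decremented. The inner or the outer multiplication by
`rightPow i` therefore always carries on the leading part, and that part always comes from the
second summand. -/
lemma LowersLeft.add_right {i a b : ℕ} {r : PowerSeries (ZMod 2)} (hb : b < 2 ^ (i + 1))
    (ih : ∀ c d, expo c d < expo a (b + 2 ^ (i + 1)) → LowersLeft T c d)
    (hr : r ∈ lower (2 * a + 3 * b + 6 * 2 ^ i - 2))
    (hT : T (rightPow (i + 1) * codePow a b) = rightPow i * T (rightPow i * codePow a b) +
      rightPow (i + 1) * T (codePow a b) + r) : LowersLeft T a (b + 2 ^ (i + 1)) := by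
  have hpos : 0 < 2 ^ i := by positivity
  have hpos4 : 0 < 4 ^ i := by positivity
  have he := expo_add_right (i + 1) a b (div_two_pow_mod_two_of_lt hb)
  rw [pow_succ 4] at he
  have h0 := rightPow_mul_mem (i := i + 1) (ih a b (by omega))
  rw [mul_sub, rightPow_mul_predLeft (div_two_pow_mod_two_of_lt hb)] at h0
  rw [rightPow_mul_codePow (div_two_pow_mod_two_of_lt hb)] at hT
  rw [LowersLeft, hT]
  have e2 : 2 ^ (i + 1) = 2 * 2 ^ i := pow_succ' _ _
  have key : rightPow i * T (rightPow i * codePow a b) ∈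
      lower (2 * a + 3 * (b + 2 ^ (i + 1)) - 2) := by
    rcases lt_or_bit hb with h | h
    · have e1 := expo_add_right i a b (div_two_pow_mod_two_of_lt h)
      have h1 := rightPow_mul_mem (i := i) (ih a (b + 2 ^ i) (by omega))
      rw [rightPow_mul_codePow (div_two_pow_mod_two_of_lt h)]
      rw [mul_sub] at h1
      rcases a with _ | a
      · rw [predLeft_zero, mul_zero (rightPow i), sub_zero] at h1
        exact lower_mono (by omega) h1
      · obtain ⟨c, d, h2, -, -, h3⟩ := exists_rightPow_mul i a (b + 2 ^ i)
        replace h3 := h3 (add_div_two_pow_mod_two_of_lt h)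
        rw [predLeft_succ, h2] at h1
        have h5 : codePow c d ∈ lower (2 * (a + 1) + 3 * (b + 2 ^ (i + 1)) - 2) :=
          codePow_mem_lower (by omega)
        rw [← sub_add_cancel (rightPow i * _) (codePow c d)]
        exact add_mem (lower_mono (by omega) h1) h5
    · obtain ⟨c, d, h2, h2', -, h3⟩ := exists_rightPow_mul i a b
      replace h3 := h3 h
      have h1 := rightPow_mul_mem (i := i) (ih c d (by omega)).mem
      rw [h2]
      exact lower_mono (by omega) h1
  rw [add_right_comm, add_sub_assoc]
  exact add_mem (add_mem key (lower_mono (by omega) hr)) (lower_mono (by omega) h0)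

lemma LowersRight.add_left {i a b : ℕ} {r : PowerSeries (ZMod 2)} (ha : a < 2 ^ (i + 1))
    (ih : ∀ c d, expo c d < expo (a + 2 ^ (i + 1)) b → LowersRight T c d)
    (hr : r ∈ lower (2 * a + 3 * b + 4 * 2 ^ i - 3))
    (hT : T (leftPow (i + 1) * codePow a b) = leftPow i * T (leftPow i * codePow a b) +
      leftPow (i + 1) * T (codePow a b) + r) : LowersRight T (a + 2 ^ (i + 1)) b := by
  have hpos : 0 < 2 ^ i := by positivity
  have hpos4 : 0 < 4 ^ i := by positivity
  have he := expo_add_left (i + 1) a b (div_two_pow_mod_two_of_lt ha)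
  rw [pow_succ 4] at he
  have h0 := leftPow_mul_mem (i := i + 1) (ih a b (by omega))
  rw [mul_sub, leftPow_mul_predRight (div_two_pow_mod_two_of_lt ha)] at h0
  rw [leftPow_mul_codePow (div_two_pow_mod_two_of_lt ha)] at hT
  rw [LowersRight, hT]
  have e2 : 2 ^ (i + 1) = 2 * 2 ^ i := pow_succ' _ _
  have key : leftPow i * T (leftPow i * codePow a b) ∈
      lower (2 * (a + 2 ^ (i + 1)) + 3 * b - 3) := by
    rcases lt_or_bit ha with h | h
    · have e1 := expo_add_left i a b (div_two_pow_mod_two_of_lt h)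
      have h1 := leftPow_mul_mem (i := i) (ih (a + 2 ^ i) b (by omega))
      rw [leftPow_mul_codePow (div_two_pow_mod_two_of_lt h)]
      rw [mul_sub] at h1
      rcases b with _ | b
      · rw [predRight_zero, mul_zero (leftPow i), sub_zero] at h1
        exact lower_mono (by omega) h1
      · obtain ⟨c, d, h2, -, -, h3⟩ := exists_leftPow_mul i (a + 2 ^ i) b
        replace h3 := h3 (add_div_two_pow_mod_two_of_lt h)
        rw [predRight_succ, h2] at h1
        have h5 : codePow c d ∈ lower (2 * (a + 2 ^ (i + 1)) + 3 * (b + 1) - 3) :=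
          codePow_mem_lower (by omega)
        rw [← sub_add_cancel (leftPow i * _) (codePow c d)]
        exact add_mem (lower_mono (by omega) h1) h5
    · obtain ⟨c, d, h2, h2', -, h3⟩ := exists_leftPow_mul i a b
      replace h3 := h3 h
      have h1 := leftPow_mul_mem (i := i) (ih c d (by omega)).mem
      rw [h2]
      exact lower_mono (by omega) h1
  rw [add_right_comm, add_sub_assoc]
  exact add_mem (add_mem key (lower_mono (by omega) hr)) (lower_mono (by omega) h0)

end Induction

/-! ### Leading terms of `T_3` and `T_5`. -/

lemma exists_eq_add_top (a : ℕ) (ha : a ≠ 0) :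
    ∃ i c, a = c + 2 ^ i ∧ c < 2 ^ i := by
  have h1 := Nat.pow_log_le_self 2 ha
  have h2 := Nat.lt_pow_succ_log_self one_lt_two a
  rw [pow_succ] at h2
  exact ⟨Nat.log 2 a, a - 2 ^ Nat.log 2 a, by omega, by omega⟩

lemma spread_values : spread 0 = 0 ∧ spread 1 = 1 ∧ spread 2 = 4 ∧ spread 3 = 5 := by
  norm_num [spread, Nat.ofDigits]

theorem lowersLeft_hecke_three (a b : ℕ) : LowersLeft (hecke 3) a b := by
  induction hn : expo a b using Nat.strong_induction_on generalizing a b with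
  | _ n ih =>
    subst hn
    by_cases ha : 2 ≤ a
    · obtain ⟨i, c, rfl, hc⟩ := exists_eq_add_top a (by omega)
      rcases i with _ | i
      · omega
      · exact LowersLeft.add_left hc (fun x y h => ih _ h x y rfl) (zero_mem _)
          (by rw [hecke_three_leftPow_mul, add_zero])
    by_cases hb : 2 ≤ b
    · obtain ⟨i, c, rfl, hc⟩ := exists_eq_add_top b (by omega)
      rcases i with _ | i
      · omega
      · exact LowersLeft.add_right hc (fun x y h => ih _ h x y rfl) (zero_mem _)
          (by rw [hecke_three_rightPow_mul, add_zero])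
    -- Codes with `a, b < 2` remain, that is, the exponents `1, 3, 5, 7`.
    have h3 : Odd 3 := by decide
    have h1 := hecke_delta 3 Nat.prime_three h3
    have h2 := hecke_pow_mul_two 3 h3 1
    have h4 := hecke_pow_mul_two 3 h3 2
    have h5 := hecke_three_add_four 1
    have h7 := hecke_three_add_four 3
    norm_num [h1, hecke_three_pow_three] at h2 h4 h5 h7
    rw [h2] at h5 h4
    norm_num at h4 h5
    rw [h4, mul_zero, zero_add, ← pow_succ] at h7
    obtain ⟨s0, s1, s2, s3⟩ := spread_values
    have h3' := hecke_three_pow_three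
    have : codePow 0 1 ∈ lower 4 := codePow_mem_lower (by norm_num)
    interval_cases a <;> interval_cases b <;>
      simp_all [LowersLeft, predLeft, codePow, expo]

/-- The recurrence of `T_5` by codes needs a top bit of index at least `2`, so the sixteen odd
exponents up to `31` are tabulated: even powers by squaring, odd ones by `hecke_five_add_six`. -/
lemma lowersRight_hecke_five_of_lt (a b : ℕ) (ha : a < 4) (hb : b < 4) :
    LowersRight (hecke 5) a b := by
  have := charP_two
  have h2 : (2 : PowerSeries (ZMod 2)) = 0 := CharTwo.two_eq_zero
  have h5 : Odd 5 := by decide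
  have step : ∀ {l : ℕ} {f₁ f₄ f₂ f₀ : PowerSeries (ZMod 2)}, hecke 5 (delta ^ (l + 1)) = f₁ →
      hecke 5 (delta ^ (l + 4)) = f₄ → hecke 5 (delta ^ (l + 2)) = f₂ →
      hecke 5 (delta ^ l) = f₀ → hecke 5 (delta ^ (l + 6)) =
        delta * f₁ + delta ^ 2 * f₄ + delta ^ 4 * f₂ + delta ^ 6 * f₀ := by
    rintro l _ _ _ _ rfl rfl rfl rfl
    exact hecke_five_add_six l
  have s1 : hecke 5 (delta ^ 1) = 0 := by
    rw [pow_one, hecke_delta 5 Nat.prime_five h5]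
  have s2 : hecke 5 (delta ^ 2) = 0 :=
    (hecke_pow_mul_two 5 h5 1).trans (by rw [s1]; ring)
  have s3 : hecke 5 (delta ^ 3) = 0 := hecke_five_pow_three
  have s4 : hecke 5 (delta ^ 4) = 0 :=
    (hecke_pow_mul_two 5 h5 2).trans (by rw [s2]; ring)
  have s5 : hecke 5 (delta ^ 5) = delta := hecke_five_pow_five
  have s6 : hecke 5 (delta ^ 6) = 0 :=
    (hecke_pow_mul_two 5 h5 3).trans (by rw [s3]; ring)
  have s7 : hecke 5 (delta ^ 7) = delta ^ 3 :=
    (step s2 s5 s3 s1).trans (by ring)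
  have s8 : hecke 5 (delta ^ 8) = 0 :=
    (hecke_pow_mul_two 5 h5 4).trans (by rw [s4]; ring)
  have s9 : hecke 5 (delta ^ 9) = 0 :=
    (step s4 s7 s5 s3).trans (by linear_combination (delta ^ 5) * h2)
  have s10 : hecke 5 (delta ^ 10) = delta ^ 2 :=
    (hecke_pow_mul_two 5 h5 5).trans (by rw [s5])
  have s11 : hecke 5 (delta ^ 11) = 0 :=
    (step s6 s9 s7 s5).trans (by linear_combination (delta ^ 7) * h2)
  have s12 : hecke 5 (delta ^ 12) = 0 :=
    (hecke_pow_mul_two 5 h5 6).trans (by rw [s6]; ring)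
  have s13 : hecke 5 (delta ^ 13) = delta ^ 9 :=
    (step s8 s11 s9 s7).trans (by ring)
  have s14 : hecke 5 (delta ^ 14) = delta ^ 6 :=
    (hecke_pow_mul_two 5 h5 7).trans (by rw [s7]; ring)
  have s15 : hecke 5 (delta ^ 15) = delta ^ 3 + delta ^ 11 :=
    (step s10 s13 s11 s9).trans (by ring)
  have s16 : hecke 5 (delta ^ 16) = 0 :=
    (hecke_pow_mul_two 5 h5 8).trans (by rw [s8]; ring)
  have s17 : hecke 5 (delta ^ 17) = delta ^ 5 :=
    (step s12 s15 s13 s11).trans (by linear_combination (delta ^ 13) * h2)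
  have s18 : hecke 5 (delta ^ 18) = 0 :=
    (hecke_pow_mul_two 5 h5 9).trans (by rw [s9]; ring)
  have s19 : hecke 5 (delta ^ 19) = delta ^ 7 :=
    (step s14 s17 s15 s13).trans (by linear_combination (delta ^ 7 + delta ^ 15) * h2)
  have s20 : hecke 5 (delta ^ 20) = delta ^ 4 :=
    (hecke_pow_mul_two 5 h5 10).trans (by rw [s10]; ring)
  have s21 : hecke 5 (delta ^ 21) = delta ^ 9 + delta ^ 17 :=
    (step s16 s19 s17 s15).trans (by linear_combination (delta ^ 9) * h2)
  have s22 : hecke 5 (delta ^ 22) = 0 :=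
    (hecke_pow_mul_two 5 h5 11).trans (by rw [s11]; ring)
  have s23 : hecke 5 (delta ^ 23) = delta ^ 11 + delta ^ 19 :=
    (step s18 s21 s19 s17).trans (by linear_combination (delta ^ 11) * h2)
  have s24 : hecke 5 (delta ^ 24) = 0 :=
    (hecke_pow_mul_two 5 h5 12).trans (by rw [s12]; ring)
  have s25 : hecke 5 (delta ^ 25) = delta ^ 5 + delta ^ 13 :=
    (step s20 s23 s21 s19).trans (by linear_combination (delta ^ 13 + delta ^ 21) * h2)
  have s26 : hecke 5 (delta ^ 26) = delta ^ 18 :=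
    (hecke_pow_mul_two 5 h5 13).trans (by rw [s13]; ring)
  have s27 : hecke 5 (delta ^ 27) = delta ^ 7 + delta ^ 15 :=
    (step s22 s25 s23 s21).trans (by linear_combination (delta ^ 15 + delta ^ 23) * h2)
  have s29 : hecke 5 (delta ^ 29) = delta ^ 17 + delta ^ 25 :=
    (step s24 s27 s25 s23).trans (by linear_combination (delta ^ 9 + delta ^ 17) * h2)
  have s31 : hecke 5 (delta ^ 31) = delta ^ 27 :=
    (step s26 s29 s27 s25).trans (by linear_combination (delta ^ 11 + 2 * delta ^ 19) * h2)

  rw [pow_one] at s1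
  obtain ⟨e0, e1, e2, e3⟩ := spread_values
  have m3 : codePow 1 0 ∈ lower 6 := codePow_mem_lower (by norm_num)
  have m9 : codePow 2 0 ∈ lower 6 := codePow_mem_lower (by norm_num)
  have m11 : codePow 3 0 ∈ lower 8 := codePow_mem_lower (by norm_num)
  have m5 : codePow 0 1 ∈ lower 7 := codePow_mem_lower (by norm_num)
  have m7 : codePow 1 1 ∈ lower 9 := codePow_mem_lower (by norm_num)
  have m17 : codePow 0 2 ∈ lower 10 := codePow_mem_lower (by norm_num)
  simp only [codePow, expo, e0, e1, e2, e3] at m3 m5 m7 m9 m11 m17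
  norm_num at m3 m5 m7 m9 m11 m17
  interval_cases a <;> interval_cases b <;>
    simp [LowersRight, predRight, codePow, expo, e0, e1, e2, e3, s1, s3, s5, s7, s9, s11, s13, s15,
      s17, s19, s21, s23, s25, s27, s29, s31, m3, m5, m7, m9, m11, m17]

theorem lowersRight_hecke_five (a b : ℕ) : LowersRight (hecke 5) a b := by
  induction hn : expo a b using Nat.strong_induction_on generalizing a b with
  | _ n ih =>
    subst hn
    by_cases ha : 4 ≤ a
    · obtain ⟨i, c, rfl, hc⟩ := exists_eq_add_top a (by omega)
      rcases i with _ | _ | i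
      · omega
      · norm_num at ha hc; omega
      · have hpos : 0 < 2 ^ i := by positivity
        have hpos4 : 0 < 4 ^ i := by positivity
        have he := expo_add_left (i + 2) c b (div_two_pow_mod_two_of_lt hc)
        have e2 : 2 ^ (i + 1) = 2 * 2 ^ i := pow_succ' _ _
        have e4 : 4 ^ (i + 2) = 16 * 4 ^ i := by ring
        -- For the remainder, the multipliers have total weights `7 * 2 ^ i` and `6 * 2 ^ i`,
        -- against `8 * 2 ^ i` for the new bit. The gap of at least `1` makes up for
        -- `LowersRight.mem` giving only `lower (· - 2)`.
        refine LowersRight.add_left hc (fun x y h => ih _ h x y rfl) ?_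
          (hecke_five_leftPow_mul i (codePow c b))
        have h0 := rightPow_mul_mem (i := i + 1)
          (ih _ (by show expo c b < expo (c + 2 ^ (i + 2)) b; omega) c b rfl).mem
        obtain ⟨x, y, h, h', hle, -⟩ := exists_leftPow_mul i c b
        have h1 := (ih _ (by show expo x y < expo (c + 2 ^ (i + 2)) b; omega) x y rfl).mem
        rw [← h] at h1
        have h1' := leftPow_mul_mem (i := i) (rightPow_mul_mem (i := i) h1)
        exact add_mem (lower_mono (by omega) h1') (lower_mono (by omega) h0)
    by_cases hb : 4 ≤ b
    · obtain ⟨i, c, rfl, hc⟩ := exists_eq_add_top b (by omega)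
      rcases i with _ | _ | i
      · omega
      · norm_num at hb hc
        omega
      · have hpos : 0 < 2 ^ i := by positivity
        have hpos4 : 0 < 4 ^ i := by positivity
        have he := expo_add_right (i + 2) a c (div_two_pow_mod_two_of_lt hc)
        have e2 : 2 ^ (i + 1) = 2 * 2 ^ i := pow_succ' _ _
        have e2' : 2 ^ (i + 2) = 4 * 2 ^ i := by ring
        have e4 : 4 ^ (i + 2) = 16 * 4 ^ i := by ring
        -- The corresponding weights are `10 * 2 ^ i` and `8 * 2 ^ i`, against `12 * 2 ^ i`.
        refine LowersRight.add_right hc (fun x y h => ih _ h x y rfl) ?_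
          (hecke_five_rightPow_mul i (codePow a c))
        have h0 := leftPow_mul_mem (i := i + 2)
          (ih _ (by show expo a c < expo a (c + 2 ^ (i + 2)); omega) a c rfl).mem
        obtain ⟨x, y, h, h', hle, -⟩ := exists_rightPow_mul i a c
        have h1 := (ih _ (by show expo x y < expo a (c + 2 ^ (i + 2)); omega) x y rfl).mem
        rw [← h] at h1
        have h1' := rightPow_mul_mem (i := i) (leftPow_mul_mem (i := i + 1) h1)
        exact add_mem (lower_mono (by omega) h1') (lower_mono (by omega) h0)
    exact lowersRight_hecke_five_of_lt a b (by omega) (by omega)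

/-! ### The common kernel of `T_3` and `T_5` -/

lemma coeff_delta_pow_of_lt {m k : ℕ} (h : m < k) : coeff m (delta ^ k) = 0 := by
  obtain ⟨u, -, hu⟩ := exists_delta_eq
  rw [hu, mul_pow, coeff_X_pow_mul', if_neg (by omega)]

/-- Since `Δ ^ k` starts with `q ^ k`, the smallest exponent of a combination survives. -/
lemma linearIndependent_delta_pow : LinearIndependent (ZMod 2) fun k : ℕ => delta ^ k := by
  rw [linearIndependent_iff]
  intro c hc
  by_contra h0
  have hne : c.support.Nonempty := Finsupp.support_nonempty_iff.mpr h0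
  have hm := c.support.min'_mem hne
  set m := c.support.min' hne with hm'
  have h := congrArg (coeff m) hc
  rw [Finsupp.linearCombination_apply, Finsupp.sum, map_sum, map_zero, sum_eq_single m] at h
  · rw [coeff_smul, coeff_delta_pow_self, smul_eq_mul, mul_one] at h
    exact Finsupp.mem_support_iff.mp hm h
  · intro k hk hkm
    have : m ≤ k := c.support.min'_le k hk
    rw [coeff_smul, coeff_delta_pow_of_lt (by omega), smul_zero]
  · exact fun h => absurd hm h

lemma linearIndependent_codePow :
    LinearIndependent (ZMod 2) fun p : ℕ × ℕ => codePow p.1 p.2 :=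
  linearIndependent_delta_pow.comp (fun p : ℕ × ℕ => expo p.1 p.2) fun _ _ h =>
    Prod.ext (expo_injective h).1 (expo_injective h).2

/-- The coordinate functional on the span of the odd powers, extended arbitrarily to all power
series so that it can be applied before knowing that a Hecke image lies in the span. -/
lemma exists_codeCoeff (a b : ℕ) : ∃ φ : PowerSeries (ZMod 2) →ₗ[ZMod 2] ZMod 2,
    φ (codePow a b) = 1 ∧ (∀ c d, (c, d) ≠ (a, b) → φ (codePow c d) = 0) ∧
      ∀ n ≤ 2 * a + 3 * b, ∀ f ∈ lower n, φ f = 0 := by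
  obtain ⟨φ, hφ⟩ := LinearMap.exists_extend
    ((Finsupp.lapply (a, b)).comp linearIndependent_codePow.repr :
      _ →ₗ[ZMod 2] ZMod 2)
  have h : ∀ c d, φ (codePow c d) = Finsupp.single (c, d) (1 : ZMod 2) (a, b) := by
    intro c d
    have hm : codePow c d ∈ Submodule.span (ZMod 2)
        (Set.range fun p : ℕ × ℕ => codePow p.1 p.2) := Submodule.subset_span ⟨(c, d), rfl⟩
    have h1 := LinearMap.congr_fun hφ ⟨codePow c d, hm⟩
    have h2 := linearIndependent_codePow.repr_eq_single (c, d) ⟨codePow c d, hm⟩ rfl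
    simpa [h2] using h1
  have h' : ∀ c d, (c, d) ≠ (a, b) → φ (codePow c d) = 0 := fun c d hcd => by
    rw [h, Finsupp.single_eq_of_ne hcd.symm]
  refine ⟨φ, by rw [h, Finsupp.single_eq_same], h', fun n hn f hf => ?_⟩
  have : lower n ≤ LinearMap.ker φ := by
    rw [lower, Submodule.span_le]
    rintro _ ⟨c, d, hcd, rfl⟩
    refine h' c d fun e => ?_
    simp only [Prod.mk.injEq] at e
    omega
  exact this hf

lemma oddForms_eq : oddForms =
    Submodule.span (ZMod 2) (Set.range fun p : ℕ × ℕ => codePow p.1 p.2) := by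
  rw [oddForms]
  congr 1
  ext f
  constructor
  · rintro ⟨k, rfl⟩
    obtain ⟨a, b, h⟩ := exists_expo k
    exact ⟨(a, b), by simp [codePow, h]⟩
  · rintro ⟨⟨a, b⟩, rfl⟩
    exact ⟨spread a + 2 * spread b, rfl⟩

/-- If a linear map sends each `codePow p` to `v p` up to terms of weight less than that of `q`,
for the `p` in the support of `c`, and `v p` involves `codePow q` exactly for `p = p₀`, then the
image of the combination with coefficients `c` is not zero. -/
lemma apply_linearCombination_ne_zero
    (T : PowerSeries (ZMod 2) →ₗ[ZMod 2] PowerSeries (ZMod 2)) (c : ℕ × ℕ →₀ ZMod 2)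
    {p₀ q : ℕ × ℕ} (hp₀ : p₀ ∈ c.support) (v : ℕ × ℕ → PowerSeries (ZMod 2))
    (hv₀ : v p₀ = codePow q.1 q.2)
    (hv : ∀ p, p ≠ p₀ → v p = 0 ∨ ∃ r, r ≠ q ∧ v p = codePow r.1 r.2)
    (hT : ∀ p ∈ c.support, ∃ n ≤ 2 * q.1 + 3 * q.2, T (codePow p.1 p.2) - v p ∈ lower n) :
    T (Finsupp.linearCombination (ZMod 2) (fun p : ℕ × ℕ => codePow p.1 p.2) c) ≠ 0 := by
  obtain ⟨φ, h1, h2, h3⟩ := exists_codeCoeff q.1 q.2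
  intro h
  have h' := congrArg φ h
  have key : ∀ p ∈ c.support, φ (T (codePow p.1 p.2)) = φ (v p) := by
    intro p hp
    obtain ⟨n, hn, hm⟩ := hT p hp
    rw [← sub_eq_zero, ← map_sub]
    exact h3 n hn _ hm
  rw [Finsupp.linearCombination_apply, Finsupp.sum, map_sum, map_sum, map_zero,
    sum_eq_single p₀] at h'
  · rw [map_smul, map_smul, key _ hp₀, hv₀, h1, smul_eq_mul, mul_one] at h'
    exact Finsupp.mem_support_iff.mp hp₀ h'
  · intro p hp hne
    rw [map_smul, map_smul, key _ hp]
    rcases hv p hne with h0 | ⟨r, hr, h0⟩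
    · rw [h0, map_zero, smul_zero]
    · rw [h0, h2 r.1 r.2 hr, smul_zero]
  · exact fun h => absurd hp₀ h

theorem eq_delta_of_hecke_eq_zero {f : PowerSeries (ZMod 2)} (hf : f ∈ oddForms) (hf0 : f ≠ 0)
    (h3 : hecke 3 f = 0) (h5 : hecke 5 f = 0) : f = delta := by
  rw [oddForms_eq, Finsupp.mem_span_range_iff_exists_finsupp] at hf
  obtain ⟨c, rfl⟩ := hf
  have hne : c.support.Nonempty := by
    rw [Finsupp.support_nonempty_iff]
    rintro rfl
    simp at hf0
  obtain ⟨⟨a, b⟩, hp, hmax⟩ := c.support.exists_max_image (fun p => 2 * p.1 + 3 * p.2) hne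
  dsimp only at hmax
  -- Otherwise `(a - 1, b)` is the decrement of `(a, b)` alone, and by maximality the error terms
  -- all have weight below that of `(a - 1, b)`.
  have ha : a = 0 := by
    rcases a with _ | a
    · rfl
    refine absurd h3 (apply_linearCombination_ne_zero (hecke 3) c hp (q := (a, b))
      (fun p => predLeft p.1 p.2) (predLeft_succ a b) ?_ fun p hp' =>
        ⟨2 * p.1 + 3 * p.2 - 2, ?_, lowersLeft_hecke_three p.1 p.2⟩)
    · rintro ⟨x, y⟩ hxy
      rcases x with _ | x
      · exact Or.inl (predLeft_zero y)
      · refine Or.inr ⟨(x, y), ?_, predLeft_succ x y⟩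
        rintro ⟨⟩
        exact hxy rfl
    · have := hmax p hp'
      dsimp only
      omega
  have hb : b = 0 := by
    rcases b with _ | b
    · rfl
    refine absurd h5 (apply_linearCombination_ne_zero (hecke 5) c hp (q := (a, b))
      (fun p => predRight p.1 p.2) (predRight_succ a b) ?_ fun p hp' =>
        ⟨2 * p.1 + 3 * p.2 - 3, ?_, lowersRight_hecke_five p.1 p.2⟩)
    · rintro ⟨x, y⟩ hxy
      rcases y with _ | y
      · exact Or.inl (predRight_zero x)
      · refine Or.inr ⟨(x, y), ?_, predRight_succ x y⟩
        rintro ⟨⟩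
        exact hxy rfl
    · have := hmax p hp'
      dsimp only
      omega
  subst ha hb
  -- The maximal weight is now `0`, and only the code `(0, 0)`, of exponent `1`, has weight `0`.
  have hsupp : c.support = {(0, 0)} := by
    refine Finset.eq_singleton_iff_unique_mem.mpr ⟨hp, fun p hp' => ?_⟩
    have := hmax p hp'
    exact Prod.ext (by dsimp only; omega) (by dsimp only; omega)
  have hc : c (0, 0) = 1 := (Fin.eq_one_of_ne_zero _ (Finsupp.mem_support_iff.mp hp))
  rw [Finsupp.sum, hsupp, sum_singleton, hc, one_smul, codePow]
  simp [expo, spread_zero]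

end ModTwo

theorem mainTheorem6 (f : PowerSeries (ZMod 2)) (hf : f ∈ ModTwo.oddForms) (hf0 : f ≠ 0)
    (h3 : ModTwo.hecke 3 f = 0) (h5 : ModTwo.hecke 5 f = 0) : f = ModTwo.delta :=
  ModTwo.eq_delta_of_hecke_eq_zero hf hf0 h3 h5
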